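/- Let $n\ge 2$ be even, $0\le m\le n$, and let $X$ be a smooth $n$-dimensional manifold with frame bundle $LX$. Let $\eta$ be the form on $\mathbb R^n$ with $m$ signs $+1$ followed by $n-m$ signs $-1$, let $\mathcal C(m,n-m)$ be its real Clifford algebra ($v^2=\eta(v,v)$), and let $\mathbb C\mathcal C(n)=\mathbb C\otimes_{\mathbb R}\mathcal C(n,0)$, which contains $\mathcal C(m,n-m)$ as the real subring generated by $e^1,\dots,e^m,ie^{m+1},\dots,ie^n$. Let $\mathcal{GC}(n)$ be the group of invertible elements of $\mathbb C\mathcal C(n)$. Let $\mathrm{Pin}(m,n-m)\subset\mathcal C(m,n-m)$ be the group generated by the vectors $v$ with $\eta(v,v)=\pm1$, let $\zeta:\mathrm{Pin}(m,n-m)\to O(m,n-m)$ be $\zeta(g)v=gvg^{-1}$, and let $\Psi\subset\mathbb C\mathcal C(n)$ be a minimal left ideal (a spinor space). A $\mathrm{Pin}$-lift of an $O(m,n-m)$-bundle $L\to B$ is a principal $\mathrm{Pin}(m,n-m)$-bundle $Q\to B$ with an epimorphism $Q\to L$ over $B$ (a surjective submersion) that is equivariant along $\zeta$; an equivalence of two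 such lifts is an equivariant diffeomorphism over $L$. For a principal $\mathrm{Pin}(m,n-m)$-bundle $Q\to B$ put $\widetilde Q=(Q\times\mathcal{GC}(n))/\mathrm{Pin}(m,n-m)$, a principal $\mathcal{GC}(n)$-bundle, and let $\mathcal C_Q=(\widetilde Q\times\mathbb C\mathcal C(n))/\mathcal{GC}(n)$ and $S_Q=(\widetilde Q\times\Psi)/\mathcal{GC}(n)\subset \mathcal C_Q$, where $\mathcal{GC}(n)$ acts by left multiplications; let $\mathcal C_Q(m,n-m)\subset\mathcal C_Q$ be the subbundle of the classes $[[q,1],a]$ with $a\in\mathcal C(m,n-m)$. Let $\Sigma=\Sigma(m,n-m)=LX/O(m,n-m)$, and suppose that a $\mathrm{Pin}$-lift $P\to LX$ of the $O(m,n-m)$-bundle $LX\to\Sigma$ is given. Write $\mathcal C_\Sigma=\mathcal C_P$, $\mathcal C_\Sigma(m,n-m)=\mathcal C_P(m,n-m)$, $S_\Sigma=S_P$. Let $h$ be a smooth global section of $\Sigma\to X$ (a pseudo-Riemannian metric of signature $(m,n-m)$), and let $L^hX\subset LX$ be the reduced $O(m,n-m)$-subbundle, the preimage of $h(X)$ under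 $LX\to\Sigma$. Then: 1. $h^*P\to L^hX$ is a $\mathrm{Pin}$-lift of $L^hX\to X$. 2. $h^*\mathcal C_\Sigma\to X$, $h^*\mathcal C_\Sigma(m,n-m)\to X$ and $h^*S_\Sigma\to X$ are smooth fibre bundles with typical fibres $\mathbb C\mathcal C(n)$, $\mathcal C(m,n-m)$ and $\Psi$, and their canonical maps into the composite bundles $\mathcal C_\Sigma\to\Sigma\to X$, $\mathcal C_\Sigma(m,n-m)\to\Sigma\to X$ and $S_\Sigma\to\Sigma\to X$ are embeddings over $X$, i.e. they are subbundles of these. 3. Let $Q\to L^hX$ be any $\mathrm{Pin}$-lift with an equivalence $F:Q\to h^*P$ (for instance $Q=h^*P$), and write $\mathcal C^h=\mathcal C_Q$, $\mathcal C^h(m,n-m)=\mathcal C_Q(m,n-m)$, $S^h=S_Q$. Then the map $[[q,g],a]\mapsto[[F(q),g],a]$ induces diffeomorphisms over $X$ of $\mathcal C^h$, $\mathcal C^h(m,n-m)$ and $S^h$ onto $h^*\mathcal C_\Sigma$, $h^*\mathcal C_\Sigma(m,n-m)$ and $h^*S_\Sigma$, compatible with the inclusions of the real Clifford subbundles and of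 the spinor subbundles. 4. If the Čech cohomology group $H^1(X;\mathbb Z_2)$ is trivial, then every $\mathrm{Pin}$-lift of $L^hX$ is equivalent to $h^*P$; so in 3 the bundles may be built from an arbitrary $\mathrm{Pin}$-lift of $L^hX$. -/

import Mathlib

universe u v w

open scoped Manifold ContDiff TensorProduct Topology
open Diffeology

noncomputable section


namespace CompositeClifford

/-! ### Smooth structures

All total spaces below (frame bundles, quotients of them, associated bundles, pull-backs,
subbundles) are smooth manifolds.  Their smooth structures are recorded as diffeologies, i.e. through
the smooth maps `ℝᵏ → M`.  Manifolds embed fully faithfully in diffeological spaces, and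
the quotient of a manifold by a free action admitting smooth local slices, a product of manifolds
and an embedded submanifold carry the quotient, product and subspace diffeology. -/

theorem exists_smooth_cutoff {k : ℕ} {u : Set (EuclideanSpace ℝ (Fin k))} (hu : IsOpen u)
    {x : EuclideanSpace ℝ (Fin k)} (hx : x ∈ u) :
    ∃ f : EuclideanSpace ℝ (Fin k) → EuclideanSpace ℝ (Fin k),
      ContDiff ℝ ∞ f ∧ (∀ y, f y ∈ u) ∧ f x = x ∧ f =ᶠ[𝓝 x] id := by
  obtain ⟨r, hr, hru⟩ := Metric.isOpen_iff.mp hu x hx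
  let b : ContDiffBump x := ⟨r / 3, r / 2, by linarith, by linarith⟩
  have hev : (fun y => x + b y • (y - x)) =ᶠ[𝓝 x] id := by
    filter_upwards [b.eventuallyEq_one] with y hy
    simp [hy]
  refine ⟨fun y => x + b y • (y - x), ?_, fun y => hru ?_, by simp, hev⟩
  · exact contDiff_const.add (b.contDiff.smul (contDiff_id.sub contDiff_const))
  · rw [Metric.mem_ball, dist_eq_norm, add_sub_cancel_left, norm_smul, Real.norm_of_nonneg b.nonneg]
    by_cases hy : dist y x < r / 2
    · have h1 : ‖y - x‖ < r / 2 := by rwa [← dist_eq_norm]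
      have h2 : b y * ‖y - x‖ ≤ 1 * ‖y - x‖ := by gcongr; exact b.le_one
      linarith
    · have h0 : b y = 0 := b.zero_of_le_dist (by simpa [b] using not_lt.mp hy)
      rw [h0, zero_mul]; exact hr

/-- The diffeology of a smooth manifold: the plots are the smooth maps `ℝᵏ → M`. -/
@[reducible]
def manifoldDiffeology {E H : Type*} [NormedAddCommGroup E] [NormedSpace ℝ E] [TopologicalSpace H]
    (I : ModelWithCorners ℝ E H) (M : Type*) [TopologicalSpace M] [ChartedSpace H M] :
    DiffeologicalSpace M where
  plots k := {p | ContMDiff (𝓡 k) I ∞ p}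
  constant_plots _ := contMDiff_const
  plot_reparam hp hf := ContMDiff.comp hp hf.contMDiff
  locality {k p} h := by
    intro x
    obtain ⟨u, hu, hxu, h⟩ := h x
    obtain ⟨f, hf, hfu, -, hfx⟩ := exists_smooth_cutoff hu hxu
    have h1 : ContMDiff (𝓡 k) I ∞ (p ∘ f) := h hfu hf
    refine (h1 x).congr_of_eventuallyEq ?_
    filter_upwards [hfx] with y hy
    simp [hy]

/-- The initial diffeology of a family of maps; for one injective map, the subspace diffeology. -/
@[reducible]
def initialDiffeology {ι X : Type*} {Y : ι → Type*} (d : ∀ i, DiffeologicalSpace (Y i))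
    (f : ∀ i, X → Y i) : DiffeologicalSpace X where
  plots _ := {p | ∀ i, IsPlot (f i ∘ p)}
  constant_plots _ _ := isPlot_const
  plot_reparam hp hf i := isPlot_reparam (hp i) hf
  locality h i := (d i).locality fun x => by
    obtain ⟨u, hu, hxu, h⟩ := h x
    exact ⟨u, hu, hxu, fun hfu hf => h hfu hf i⟩

instance {X : Type*} [DiffeologicalSpace X] (p : X → Prop) : DiffeologicalSpace (Subtype p) :=
  initialDiffeology (ι := Unit) (fun _ => inferInstanceAs (DiffeologicalSpace X))
    fun _ => Subtype.val

instance {X Y : Type*} [DiffeologicalSpace X] [DiffeologicalSpace Y] :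
    DiffeologicalSpace (X × Y) where
  plots _ := {p | IsPlot (Prod.fst ∘ p) ∧ IsPlot (Prod.snd ∘ p)}
  constant_plots _ := ⟨isPlot_const, isPlot_const⟩
  plot_reparam hp hf := ⟨isPlot_reparam hp.1 hf, isPlot_reparam hp.2 hf⟩
  locality h := by
    refine ⟨DiffeologicalSpace.locality fun x => ?_, DiffeologicalSpace.locality fun x => ?_⟩ <;>
      obtain ⟨u, hu, hxu, h⟩ := h x
    exacts [⟨u, hu, hxu, fun hfu hf => (h hfu hf).1⟩, ⟨u, hu, hxu, fun hfu hf => (h hfu hf).2⟩]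

/-- The quotient diffeology: plots are the maps that lift locally to plots. -/
@[reducible]
def quotientDiffeology {X Y : Type*} [DiffeologicalSpace X] (f : X → Y)
    (hf : Function.Surjective f) : DiffeologicalSpace Y where
  plots k := {p | ∀ x, ∃ q : EuclideanSpace ℝ (Fin k) → X, IsPlot q ∧ p =ᶠ[𝓝 x] f ∘ q}
  constant_plots y _ := by
    obtain ⟨x, rfl⟩ := hf y
    exact ⟨fun _ => x, isPlot_const, Filter.EventuallyEq.rfl⟩
  plot_reparam {_ _ p g} hp hg x := by
    obtain ⟨q, hq, h⟩ := hp (g x)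
    exact ⟨q ∘ g, isPlot_reparam hq hg, h.comp_tendsto hg.continuous.continuousAt⟩
  locality {k p} h x := by
    obtain ⟨u, hu, hxu, h⟩ := h x
    obtain ⟨g, hg, hgu, hgx, hgid⟩ := exists_smooth_cutoff hu hxu
    obtain ⟨q, hq, h'⟩ := h hgu hg x
    refine ⟨q, hq, ?_⟩
    filter_upwards [h', hgid] with y h1 h2
    simpa [h2] using h1

instance {X : Type*} [DiffeologicalSpace X] (s : Setoid X) : DiffeologicalSpace (Quotient s) :=
  quotientDiffeology (Quotient.mk s) Quotient.mk_surjective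

/-- The standard smooth structure of a finite-dimensional real vector space `W`: the plots are the
maps that are locally finite sums `∑ cᵢ wᵢ` with smooth real coefficients `cᵢ` and fixed
vectors `wᵢ`. -/
@[reducible]
def vectorDiffeology (W : Type*) [AddCommGroup W] [Module ℝ W] : DiffeologicalSpace W where
  plots k := {p | ∀ x, ∃ (N : ℕ) (w : Fin N → W) (c : Fin N → EuclideanSpace ℝ (Fin k) → ℝ),
    (∀ i, ContDiff ℝ ∞ (c i)) ∧ p =ᶠ[𝓝 x] fun y => ∑ i, c i y • w i}
  constant_plots w _ := ⟨1, fun _ => w, fun _ _ => 1, fun _ => contDiff_const, by simp⟩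
  plot_reparam {_ _ p g} hp hg x := by
    obtain ⟨N, w, c, hc, h⟩ := hp (g x)
    exact ⟨N, w, fun i => c i ∘ g, fun i => (hc i).comp hg,
      h.comp_tendsto hg.continuous.continuousAt⟩
  locality {k p} h x := by
    obtain ⟨u, hu, hxu, h⟩ := h x
    obtain ⟨g, hg, hgu, hgx, hgid⟩ := exists_smooth_cutoff hu hxu
    obtain ⟨N, w, c, hc, h'⟩ := h hgu hg x
    refine ⟨N, w, c, hc, ?_⟩
    filter_upwards [h', hgid] with y h1 h2
    simpa [h2] using h1

/-- The group of units of a real algebra, as the submanifold `{(u, u⁻¹)}` of `A × A`. -/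
@[reducible]
def unitsDiffeology (A : Type*) [Ring A] [DiffeologicalSpace A] : DiffeologicalSpace Aˣ :=
  initialDiffeology (ι := Unit) (fun _ => inferInstanceAs (DiffeologicalSpace (A × A)))
    fun _ u => ((u : A), ((u⁻¹ : Aˣ) : A))

/-- `e` is a diffeomorphism. -/
def IsDiffeo {X Y : Type*} [DiffeologicalSpace X] [DiffeologicalSpace Y] (e : X ≃ Y) : Prop :=
  DSmooth e ∧ DSmooth e.symm

/-! ### Bundles -/

/-- `π : E → B` is a smooth (locally trivial) fibre bundle with typical fibre `F`. -/
structure IsFibreBundle (F : Type*) [DiffeologicalSpace F] {E B : Type*} [DiffeologicalSpace E]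
    [DiffeologicalSpace B] (π : E → B) : Prop where
  smooth_proj : DSmooth π
  locally_trivial : ∀ b, ∃ U : Set B, IsOpen[dTopology] U ∧ b ∈ U ∧
    ∃ φ : (U × F) ≃ (π ⁻¹' U), IsDiffeo φ ∧ ∀ q, π (φ q) = q.1

/-- `i : Z → Y` makes the bundle `πZ : Z → X`, with typical fibre `F`, a subbundle of `πY : Y → X`:
`Z → X` is a smooth fibre bundle and `i` is an injective smooth map over `X` which is an embedding.
A smooth injective map is an embedding of manifolds iff it has smooth left inverses defined
on neighbourhoods of the points of its image. -/
structure IsSubbundle (F : Type*) [DiffeologicalSpace F] {Z Y X : Type*} [DiffeologicalSpace Z]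
    [DiffeologicalSpace Y] [DiffeologicalSpace X] (πZ : Z → X) (πY : Y → X) (i : Z → Y) :
    Prop where
  fibreBundle : IsFibreBundle F πZ
  smooth : DSmooth i
  injective : Function.Injective i
  proj_comp : ∀ z, πY (i z) = πZ z
  embedding : ∀ z, ∃ O : Set Y, IsOpen[dTopology] O ∧ i z ∈ O ∧
    ∃ r : O → Z, DSmooth r ∧ ∀ (z' : Z) (hz' : i z' ∈ O), r ⟨i z', hz'⟩ = z'

/-- `π : P → B` is a smooth principal `G`-bundle; the right action `p g` is written
`MulOpposite.op g • p`. -/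
structure IsPrincipalBundle (G : Type*) [Group G] [DiffeologicalSpace G] {P B : Type*}
    [DiffeologicalSpace P] [DiffeologicalSpace B] [MulAction Gᵐᵒᵖ P] (π : P → B) : Prop where
  smooth_proj : DSmooth π
  smooth_action : DSmooth fun q : P × G => MulOpposite.op q.2 • q.1
  proj_smul : ∀ (g : G) (p : P), π (MulOpposite.op g • p) = π p
  locally_trivial : ∀ b, ∃ U : Set B, IsOpen[dTopology] U ∧ b ∈ U ∧
    ∃ φ : (U × G) ≃ (π ⁻¹' U), IsDiffeo φ ∧ (∀ q, π (φ q) = q.1) ∧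
      ∀ (b : U) (g g' : G), (φ (b, g * g') : P) = MulOpposite.op g' • (φ (b, g) : P)

section Associated

variable (G P V : Type*) [Group G] [MulAction Gᵐᵒᵖ P] [MulAction G V]

/-- Identification of `(p, v)` with `(p g, g⁻¹ v)`. -/
def assocSetoid : Setoid (P × V) where
  r a b := ∃ g : G, b = (MulOpposite.op g • a.1, g⁻¹ • a.2)
  iseqv :=
    { refl := fun a => ⟨1, by simp⟩
      symm := by
        rintro a b ⟨g, rfl⟩
        exact ⟨g⁻¹, by simp⟩
      trans := by
        rintro a b c ⟨g, rfl⟩ ⟨g', rfl⟩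
        exact ⟨g * g', by simp [mul_smul]⟩ }

/-- The associated bundle `(P × V)/G`. -/
def Assoc : Type _ := Quotient (assocSetoid G P V)

instance [DiffeologicalSpace P] [DiffeologicalSpace V] : DiffeologicalSpace (Assoc G P V) :=
  inferInstanceAs (DiffeologicalSpace (Quotient (assocSetoid G P V)))

variable {P V}

/-- The class of `(p, v)` in `(P × V)/G`. -/
def Assoc.mk (p : P) (v : V) : Assoc G P V := Quotient.mk (assocSetoid G P V) (p, v)

variable {G}

/-- The projection of an associated bundle induced by a `G`-invariant projection of `P`. -/
def Assoc.proj {B : Type*} (π : P → B) (hπ : ∀ (g : G) (p : P), π (MulOpposite.op g • p) = π p) :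
    Assoc G P V → B :=
  Quotient.lift (fun q => π q.1) (by
    rintro a b ⟨g, rfl⟩
    exact (hπ g a.1).symm)

end Associated

/-- The pull-back of `π : E → B` along `h : X → B`. -/
def Pullback {X E B : Type*} (h : X → B) (π : E → B) : Type _ := {q : X × E // π q.2 = h q.1}

section Pullback

variable {X E B : Type*} (h : X → B) (π : E → B)

instance [DiffeologicalSpace X] [DiffeologicalSpace E] : DiffeologicalSpace (Pullback h π) :=
  inferInstanceAs (DiffeologicalSpace {q : X × E // π q.2 = h q.1})

variable {h π}

/-- The projection `h^*E → X`. -/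
def Pullback.base (q : Pullback h π) : X := q.1.1

/-- The canonical map `h^*E → E`. -/
def Pullback.total (q : Pullback h π) : E := q.1.2

end Pullback

/-! ### Clifford algebras, the Pin group and the pseudo-orthogonal group -/

/-- The pseudo-Euclidean form on `ℝⁿ` with `m` signs `+1` followed by `n - m` signs `-1`. -/
def form (m n : ℕ) : QuadraticForm ℝ (Fin n → ℝ) :=
  QuadraticMap.weightedSumSquares ℝ fun i : Fin n => if (i : ℕ) < m then (1 : ℝ) else -1

/-- The real Clifford algebra `Cl(m, n - m)`, in which `v * v = form m n v`. -/
abbrev RealClifford (m n : ℕ) : Type := CliffordAlgebra (form m n)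

/-- The complex Clifford algebra `ℂCl(n) = ℂ ⊗ Cl(n, 0)`. -/
abbrev ComplexClifford (n : ℕ) : Type := ℂ ⊗[ℝ] RealClifford n n

instance (m n : ℕ) : DiffeologicalSpace (RealClifford m n) := vectorDiffeology _
instance (n : ℕ) : DiffeologicalSpace (ComplexClifford n) := vectorDiffeology _
instance (m n : ℕ) : DiffeologicalSpace (RealClifford m n)ˣ := unitsDiffeology _
instance (n : ℕ) : DiffeologicalSpace (ComplexClifford n)ˣ := unitsDiffeology _

/-- The group of invertible elements of `ℂCl(n)`. -/
abbrev GCC (n : ℕ) : Type := (ComplexClifford n)ˣ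

/-- The group `Pin(m, n - m)` generated by the vectors `v` with `η(v, v) = ± 1`. -/
def pin (m n : ℕ) : Subgroup (RealClifford m n)ˣ :=
  Subgroup.closure {u | ∃ v : Fin n → ℝ, (u : RealClifford m n) = CliffordAlgebra.ι (form m n) v ∧
    (form m n v = 1 ∨ form m n v = -1)}

/-- `Pin(m, n - m)` as a group. -/
abbrev Pin (m n : ℕ) : Type := pin m n

/-- The pseudo-orthogonal group `O(m, n - m)`. -/
def orth (m n : ℕ) : Subgroup ((Fin n → ℝ) ≃ₗ[ℝ] (Fin n → ℝ)) where
  carrier := {A | ∀ v, form m n (A v) = form m n v}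
  one_mem' _ := rfl
  mul_mem' {A B} hA hB v := by
    change form m n (A (B v)) = _
    rw [hA, hB]
  inv_mem' {A} hA v := by
    have := hA (A⁻¹ v)
    rw [← this]
    exact congrArg (form m n) (A.apply_symm_apply v)

/-- `O(m, n - m)` as a group. -/
abbrev Orth (m n : ℕ) : Type := orth m n

theorem ι_injective (m n : ℕ) : Function.Injective (CliffordAlgebra.ι (form m n)) := by
  intro a b hab
  have := congrArg (CliffordAlgebra.equivExterior (form m n)) hab
  simpa [CliffordAlgebra.equivExterior] using this

theorem pin_le_lipschitz (m n : ℕ) : pin m n ≤ lipschitzGroup (form m n) := by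
  refine Subgroup.closure_mono ?_
  rintro u ⟨v, hv, -⟩
  exact ⟨v, hv.symm⟩

theorem exists_conj (m n : ℕ) (g : Pin m n) (v : Fin n → ℝ) :
    ∃ w, CliffordAlgebra.ι (form m n) w = ((g : (RealClifford m n)ˣ) : RealClifford m n) *
      CliffordAlgebra.ι (form m n) v * (((g : (RealClifford m n)ˣ)⁻¹ : (RealClifford m n)ˣ)) :=
  lipschitzGroup.conjAct_smul_ι_mem_range_ι (pin_le_lipschitz m n g.2) v

/-- `ζ(g) v = g v g⁻¹` for `g` in the Pin group. -/
def zetaFun (m n : ℕ) (g : Pin m n) (v : Fin n → ℝ) : Fin n → ℝ := (exists_conj m n g v).choose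

theorem ι_zetaFun (m n : ℕ) (g : Pin m n) (v : Fin n → ℝ) :
    CliffordAlgebra.ι (form m n) (zetaFun m n g v) =
      ((g : (RealClifford m n)ˣ) : RealClifford m n) *
      CliffordAlgebra.ι (form m n) v * (((g : (RealClifford m n)ˣ)⁻¹ : (RealClifford m n)ˣ)) :=
  (exists_conj m n g v).choose_spec

theorem zetaFun_one (m n : ℕ) (v : Fin n → ℝ) : zetaFun m n 1 v = v :=
  ι_injective m n (by simp [ι_zetaFun])

theorem zetaFun_mul (m n : ℕ) (g g' : Pin m n) (v : Fin n → ℝ) :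
    zetaFun m n (g * g') v = zetaFun m n g (zetaFun m n g' v) :=
  ι_injective m n (by simp [ι_zetaFun, mul_assoc])

theorem form_zetaFun (m n : ℕ) (g : Pin m n) (v : Fin n → ℝ) :
    form m n (zetaFun m n g v) = form m n v := by
  refine (algebraMap ℝ (RealClifford m n)).injective ?_
  rw [← CliffordAlgebra.ι_sq_scalar, ι_zetaFun]
  have h := CliffordAlgebra.ι_sq_scalar (form m n) v
  calc _ = ((g : (RealClifford m n)ˣ) : RealClifford m n) *
      (CliffordAlgebra.ι (form m n) v * CliffordAlgebra.ι (form m n) v) *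
      (((g : (RealClifford m n)ˣ)⁻¹ : (RealClifford m n)ˣ)) := by
        simp only [mul_assoc, Units.inv_mul_cancel_left]
    _ = _ := by rw [h, ← Algebra.commutes, mul_assoc, Units.mul_inv, mul_one]

/-- The homomorphism `ζ : Pin(m, n - m) → O(m, n - m)`, `ζ(g) v = g v g⁻¹`. -/
def zeta (m n : ℕ) : Pin m n →* Orth m n where
  toFun g := ⟨
    { toFun := zetaFun m n g
      invFun := zetaFun m n g⁻¹
      map_add' := fun v w => ι_injective m n (by simp [ι_zetaFun, mul_add, add_mul])
      map_smul' := fun c v => ι_injective m n (by simp [ι_zetaFun])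
      left_inv := fun v => by rw [← zetaFun_mul, inv_mul_cancel, zetaFun_one]
      right_inv := fun v => by rw [← zetaFun_mul, mul_inv_cancel, zetaFun_one] },
    form_zetaFun m n g⟩
  map_one' := by
    refine Subtype.ext (LinearEquiv.ext fun v => ?_)
    exact zetaFun_one m n v
  map_mul' g g' := by
    refine Subtype.ext (LinearEquiv.ext fun v => ?_)
    exact zetaFun_mul m n g g' v

/-- The projection of `ℝⁿ` onto its first `m` coordinates. -/
def firstCoords (m n : ℕ) : (Fin n → ℝ) →ₗ[ℝ] (Fin n → ℝ) :=
  LinearMap.pi fun i => if (i : ℕ) < m then LinearMap.proj i else 0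

/-- The generators `eⁱ ↦ eⁱ` for the first `m` indices and `eⁱ ↦ i eⁱ` for the others. -/
def generators (m n : ℕ) : (Fin n → ℝ) →ₗ[ℝ] ComplexClifford n :=
  TensorProduct.mk ℝ ℂ (RealClifford n n) 1 ∘ₗ CliffordAlgebra.ι (form n n) ∘ₗ firstCoords m n +
    TensorProduct.mk ℝ ℂ (RealClifford n n) Complex.I ∘ₗ CliffordAlgebra.ι (form n n) ∘ₗ
      (LinearMap.id - firstCoords m n)

theorem generators_sq (m n : ℕ) (v : Fin n → ℝ) :
    generators m n v * generators m n v = algebraMap ℝ (ComplexClifford n) (form m n v) := by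
  set a := firstCoords m n v with ha
  set b := v - firstCoords m n v with hb
  have hab : CliffordAlgebra.ι (form n n) a * CliffordAlgebra.ι (form n n) b +
      CliffordAlgebra.ι (form n n) b * CliffordAlgebra.ι (form n n) a = 0 := by
    refine CliffordAlgebra.ι_mul_ι_add_swap_of_isOrtho ?_
    simp only [QuadraticMap.isOrtho_def, form, QuadraticMap.weightedSumSquares_apply, ha, hb,
      firstCoords, ← Finset.sum_add_distrib]
    refine Finset.sum_congr rfl fun i _ => ?_
    by_cases h : (i : ℕ) < m <;> simp [h]
  have hQ : form m n v = form n n a - form n n b := by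
    simp only [form, QuadraticMap.weightedSumSquares_apply, ha, hb, firstCoords,
      ← Finset.sum_sub_distrib]
    refine Finset.sum_congr rfl fun i _ => ?_
    by_cases h : (i : ℕ) < m <;> simp [h]
  have hv : generators m n v = (1 : ℂ) ⊗ₜ[ℝ] CliffordAlgebra.ι (form n n) a +
      Complex.I ⊗ₜ[ℝ] CliffordAlgebra.ι (form n n) b := by
    simp [generators, ha, hb]
  rw [hv, hQ, add_mul, mul_add, mul_add]
  simp only [Algebra.TensorProduct.tmul_mul_tmul, one_mul, mul_one, Complex.I_mul_I,
    CliffordAlgebra.ι_sq_scalar]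
  have h2 : Complex.I ⊗ₜ[ℝ] (CliffordAlgebra.ι (form n n) a * CliffordAlgebra.ι (form n n) b) +
      Complex.I ⊗ₜ[ℝ] (CliffordAlgebra.ι (form n n) b * CliffordAlgebra.ι (form n n) a) =
      (0 : ComplexClifford n) := by
    rw [← TensorProduct.tmul_add, hab, TensorProduct.tmul_zero]
  have h3 : ∀ r : ℝ, (1 : ℂ) ⊗ₜ[ℝ] (algebraMap ℝ (RealClifford n n) r) =
      algebraMap ℝ (ComplexClifford n) r := fun r => by
    rw [Algebra.algebraMap_eq_smul_one, TensorProduct.tmul_smul, Algebra.algebraMap_eq_smul_one,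
      Algebra.TensorProduct.one_def]
  clear_value a b
  rw [TensorProduct.neg_tmul, h3, h3, map_sub, sub_eq_add_neg]
  rw [eq_neg_of_add_eq_zero_right h2]
  abel

/-- The canonical inclusion `Cl(m, n - m) → ℂCl(n)`. -/
def realIncl (m n : ℕ) : RealClifford m n →ₐ[ℝ] ComplexClifford n :=
  CliffordAlgebra.lift (form m n) ⟨generators m n, generators_sq m n⟩

/-- The induced homomorphism of `Pin(m, n - m)` to the group of invertible elements of `ℂCl(n)`. -/
def pinToGCC (m n : ℕ) : Pin m n →* GCC n :=
  (Units.map (realIncl m n).toRingHom.toMonoidHom).comp (pin m n).subtype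

/-- `Pin(m, n - m)` acts on the invertible elements of `ℂCl(n)` by left multiplications. -/
instance pinAction (m n : ℕ) : MulAction (Pin m n) (GCC n) := MulAction.compHom _ (pinToGCC m n)

/-! ### The frame bundle, metrics and reduced subbundles -/

section Frames

variable (m n : ℕ) (X : Type*) [TopologicalSpace X] [ChartedSpace (EuclideanSpace ℝ (Fin n)) X]
  [IsManifold (𝓡 n) ∞ X]

/-- The frame bundle `LX`: a point is `x : X` with a linear isomorphism `ℝⁿ → T_x X`. -/
def FrameBundle : Type _ := Σ x : X, (Fin n → ℝ) ≃ₗ[ℝ] TangentSpace (𝓡 n) x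

/-- A family of frames is smooth iff the vectors of the frames are smooth in `TX`. -/
instance : DiffeologicalSpace (FrameBundle n X) :=
  initialDiffeology (ι := Fin n → ℝ)
    (fun _ => manifoldDiffeology (𝓡 n).tangent (TangentBundle (𝓡 n) X))
    fun v f => ⟨f.1, f.2 v⟩

/-- The right action of `O(m, n - m)` on frames, by composition on the right. -/
instance : MulAction (Orth m n)ᵐᵒᵖ (FrameBundle n X) where
  smul A f := ⟨f.1, (A.unop : (Fin n → ℝ) ≃ₗ[ℝ] (Fin n → ℝ)) ≪≫ₗ f.2⟩
  one_smul _ := rfl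
  mul_smul _ _ _ := rfl

/-- `Σ(m, n - m) = LX / O(m, n - m)`. -/
def MetricBundle : Type _ := MulAction.orbitRel.Quotient (Orth m n)ᵐᵒᵖ (FrameBundle n X)

instance : DiffeologicalSpace (MetricBundle m n X) :=
  inferInstanceAs (DiffeologicalSpace (Quotient (MulAction.orbitRel _ _)))

variable {n X}

/-- The projection `LX → Σ(m, n - m)`. -/
def toMetric (f : FrameBundle n X) : MetricBundle m n X :=
  Quotient.mk (MulAction.orbitRel (Orth m n)ᵐᵒᵖ (FrameBundle n X)) f

variable {m}

/-- The projection `Σ(m, n - m) → X`. -/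
def MetricBundle.proj : MetricBundle m n X → X :=
  Quotient.lift (fun f : FrameBundle n X => f.1) (by
    rintro _ f ⟨A, rfl⟩
    rfl)

/-- `h` is a smooth global section of `Σ(m, n - m) → X`. -/
def IsGlobalSection (h : X → MetricBundle m n X) : Prop :=
  @DSmooth X (MetricBundle m n X) (manifoldDiffeology (𝓡 n) X) _ h ∧ ∀ x, (h x).proj = x

/-- The reduced subbundle `L^hX`, the preimage of `h(X)` under `LX → Σ(m, n - m)`. -/
def ReducedFrames (h : X → MetricBundle m n X) : Type _ :=
  {f : FrameBundle n X // toMetric m f ∈ Set.range h}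

variable (h : X → MetricBundle m n X)

instance : DiffeologicalSpace (ReducedFrames h) :=
  inferInstanceAs (DiffeologicalSpace {f : FrameBundle n X // toMetric m f ∈ Set.range h})

instance : MulAction (Orth m n)ᵐᵒᵖ (ReducedFrames h) where
  smul A f := ⟨A • f.1, by
    rw [show toMetric m (A • f.1) = toMetric m f.1 from Quotient.sound ⟨A, rfl⟩]
    exact f.2⟩
  one_smul _ := rfl
  mul_smul _ _ _ := rfl

variable {h}

/-- The projection `L^hX → X`. -/
def ReducedFrames.proj (f : ReducedFrames h) : X := f.1.1

end Frames

/-- `z : Q → L` is a `Pin(m, n - m)`-lift (extension, cover) of the `O(m, n - m)`-bundle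
`πL : L → B`: `Q → L → B` is a principal `Pin(m, n - m)`-bundle, and `z` is an epimorphism of
principal bundles along `ζ`, i.e. `z(q g) = z(q) ζ(g)` and `z` is a surjective submersion
(every plot of `L` lifts locally to `Q`). -/
structure IsPinLift (m n : ℕ) {Q L B : Type*} [DiffeologicalSpace Q] [DiffeologicalSpace L]
    [DiffeologicalSpace B] [MulAction (Pin m n)ᵐᵒᵖ Q] [MulAction (Orth m n)ᵐᵒᵖ L]
    (πL : L → B) (z : Q → L) : Prop where
  principal : IsPrincipalBundle (Pin m n) (πL ∘ z)
  smooth : DSmooth z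
  equivariant : ∀ (g : Pin m n) (q : Q),
    z (MulOpposite.op g • q) = MulOpposite.op (zeta m n g) • z q
  surjective : Function.Surjective z
  submersive : ∀ (k : ℕ) (p : EuclideanSpace ℝ (Fin k) → L), IsPlot p →
    ∀ x, ∃ q : EuclideanSpace ℝ (Fin k) → Q, IsPlot q ∧ p =ᶠ[𝓝 x] z ∘ q

/-! ### Clifford algebra bundles and spinor bundles -/

section Clifford

variable (m n : ℕ) (P : Type*) [MulAction (Pin m n)ᵐᵒᵖ P]

/-- The principal bundle `(P × GCC(n)) / Pin(m, n - m)` with structure group the invertible elements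
of `ℂCl(n)`, induced from a principal `Pin(m, n - m)`-bundle `P`. -/
abbrev Ext : Type _ := Assoc (Pin m n) P (GCC n)

/-- `[p, g] g' = [p, g g']`. -/
instance : MulAction (GCC n)ᵐᵒᵖ (Ext m n P) where
  smul g' := Quotient.map (fun q => (q.1, q.2 * g'.unop)) (by
    rintro a b ⟨g, rfl⟩
    exact ⟨g, Prod.ext rfl (mul_assoc (pinToGCC m n g⁻¹) _ _)⟩)
  one_smul c := by
    induction c using Quotient.inductionOn with
    | h q => exact congrArg (Quotient.mk _) (Prod.ext rfl (mul_one _))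
  mul_smul g g' c := by
    induction c using Quotient.inductionOn with
    | h q => exact congrArg (Quotient.mk _) (Prod.ext rfl (mul_assoc _ _ _).symm)

/-- The bundle in complex Clifford algebras associated to `Ext m n P` by left multiplications. -/
abbrev CliffordBundle : Type _ := Assoc (GCC n) (Ext m n P) (ComplexClifford n)

/-- The bundle in spinor spaces associated to `Ext m n P`, for a left ideal `Ψ` of `ℂCl(n)`. -/
abbrev SpinorBundle (Ψ : Ideal (ComplexClifford n)) : Type _ := Assoc (GCC n) (Ext m n P) Ψ

variable {P}

/-- The element `[[p, g], a]` of the Clifford bundle or of a spinor bundle. -/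
def cmk {V : Type*} [MulAction (GCC n) V] (p : P) (g : GCC n) (a : V) :
    Assoc (GCC n) (Ext m n P) V :=
  Assoc.mk (GCC n) (Assoc.mk (Pin m n) p g) a

/-- The projection to `B` of a bundle associated to `Ext m n P`. -/
def cproj {V B : Type*} [MulAction (GCC n) V] (π : P → B)
    (hπ : ∀ (g : Pin m n) (p : P), π (MulOpposite.op g • p) = π p) :
    Assoc (GCC n) (Ext m n P) V → B :=
  Assoc.proj (Assoc.proj π hπ) (by
    intro g c
    induction c using Quotient.inductionOn with
    | h q => rfl)

variable (P)

/-- The subbundle in real Clifford algebras `Cl(m, n - m)` of the Clifford bundle. -/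
def RealCliffordBundle : Set (CliffordBundle m n P) :=
  {c | ∃ (p : P) (a : RealClifford m n), c = cmk m n p 1 (realIncl m n a)}

variable {P}

/-- The inclusion of a spinor bundle in the Clifford bundle. -/
def spinorIncl (Ψ : Ideal (ComplexClifford n)) : SpinorBundle m n P Ψ → CliffordBundle m n P :=
  Quotient.map (fun q => (q.1, (q.2 : ComplexClifford n))) (by
    rintro a b ⟨g, rfl⟩
    exact ⟨g, rfl⟩)

end Clifford

section PullbackLift

variable {m n : ℕ} {X : Type*} [TopologicalSpace X] [ChartedSpace (EuclideanSpace ℝ (Fin n)) X]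
  [IsManifold (𝓡 n) ∞ X] {P : Type*} [MulAction (Pin m n)ᵐᵒᵖ P]
  (h : X → MetricBundle m n X) (z : P → FrameBundle n X)

/-- The pull-back `h^*P` of a `Pin(m, n - m)`-cover `z : P → LX`, as a bundle over `X`. -/
abbrev PullbackPin : Type _ := Pullback h (toMetric m ∘ z)

/-- The action `(x, p) g = (x, p g)` of `Pin(m, n - m)` on `h^*P`. -/
@[reducible]
def pullbackPinAction (hz : ∀ (g : Pin m n) (p : P),
    (toMetric m ∘ z) (MulOpposite.op g • p) = (toMetric m ∘ z) p) :
    MulAction (Pin m n)ᵐᵒᵖ (PullbackPin h z) where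
  smul g q := ⟨(q.1.1, g • q.1.2), (hz g.unop q.1.2).trans q.2⟩
  one_smul q := Subtype.ext (Prod.ext rfl (one_smul _ q.1.2))
  mul_smul g g' q := Subtype.ext (Prod.ext rfl (mul_smul g g' q.1.2))

/-- The induced map `h^*P → L^hX`. -/
def pullbackLift (q : PullbackPin h z) : ReducedFrames h :=
  ⟨z q.total, q.base, q.2.symm⟩

variable {h z}

/-- `F` is an equivalence of the lift `zQ : Q → L^hX` with the lift `h^*P → L^hX`: an equivariant
diffeomorphism over `L^hX`. -/
structure IsLiftEquiv {Q : Type*} [DiffeologicalSpace Q] [DiffeologicalSpace P]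
    [MulAction (Pin m n)ᵐᵒᵖ Q] (zQ : Q → ReducedFrames h) (F : Q ≃ PullbackPin h z) : Prop where
  isDiffeo : @IsDiffeo _ _ _
    (@instDiffeologicalSpacePullback _ _ _ h _ (manifoldDiffeology (𝓡 n) X) _) F
  lift : ∀ q, pullbackLift h z (F q) = zQ q
  equivariant : ∀ (g : Pin m n) (q : Q),
    (F (MulOpposite.op g • q)).total = MulOpposite.op g • (F q).total

end PullbackLift

/-- The Čech cohomology group `H¹(X; ℤ/2)` (the colimit over open covers, with locally constant
cochains) is trivial: every cocycle becomes a coboundary on a refinement. -/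
def CechH1Trivial (X : Type u) [TopologicalSpace X] : Prop :=
  ∀ (ι : Type u) (U : ι → Set X) (g : ι → ι → X → ZMod 2),
    (∀ i, IsOpen (U i)) → (∀ x, ∃ i, x ∈ U i) →
    (∀ i j, ∀ x ∈ U i ∩ U j, ∀ᶠ y in 𝓝 x, g i j y = g i j x) →
    (∀ i j k, ∀ x ∈ U i ∩ U j ∩ U k, g i j x + g j k x = g i k x) →
    ∃ (κ : Type u) (V : κ → Set X) (r : κ → ι) (c : κ → X → ZMod 2),
      (∀ a, IsOpen (V a)) ∧ (∀ x, ∃ a, x ∈ V a) ∧ (∀ a, V a ⊆ U (r a)) ∧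
      (∀ a, ∀ x ∈ V a, ∀ᶠ y in 𝓝 x, c a y = c a x) ∧
      ∀ a b, ∀ x ∈ V a ∩ V b, g (r a) (r b) x = c b x - c a x

end CompositeClifford

end

open CompositeClifford

namespace CompositeClifford

/-! ### Diffeological preliminaries -/

section Diffeological

variable {X Y Z : Type*} [DiffeologicalSpace X] [DiffeologicalSpace Y] [DiffeologicalSpace Z]

/-! Smoothness is tested on plots, and every total space is built so that its plots lift locally:
quotients by definition, principal bundles through local sections, Pin-lifts by submersivity. A lift
defined only near a point is made global by a cutoff reparametrization, and the same device keeps a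
plot inside a trivializing set.

The nested quotient defining the Clifford and spinor bundles collapses: each class is `[[p, 1], a]`,
and two such classes agree exactly when `p' = p k` and `a = k a'` for some `k` in the Pin group. So
these are bundles associated to `P` itself, and a local section `s` of `P` trivializes them by `(b,
v) ↦ [[s b, 1], v]`. The real Clifford bundle works in the same way, because `realIncl` is injective
and Pin multiplies its image into itself.

Trivializations over `Σ` pull back along `h`. Since `h` is a section of `Σ → X`, a point of `h^*E`
is determined by its image in `E`. Near that image a smooth left inverse keeps the fibre coordinate
and replaces the base point `b` by `h (pr b)`. This gives the subbundle statements for any fibre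
bundle (`IsFibreBundle.isSubbundle_pullback`). An equivalence `F` yields an equivariant map `Q → P`,
hence maps of associated bundles; these are bijective because `F` is and `h` is injective, and the
inverse is smooth because plots lift (`exists_equiv_pullback`).

For the uniqueness of Pin-lifts, two lifts are isomorphic over small open sets, and on overlaps the
isomorphisms differ by an element of the kernel of `ζ`. For even `n` this kernel is `{1, -1}`: an
element acting trivially is central, hence a real scalar `c`, and the reversal norm forces `c * c =
±1`. The signs form a locally constant Čech cocycle. If it becomes a coboundary on a refinement, the
corrected local isomorphisms glue (`exists_equiv_of_cechH1Trivial`). -/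

theorem isPlot_of_eventuallyEq {k : ℕ} {p : EuclideanSpace ℝ (Fin k) → X}
    (hp : ∀ x, ∃ q : EuclideanSpace ℝ (Fin k) → X, IsPlot q ∧ p =ᶠ[𝓝 x] q) : IsPlot p := by
  refine DiffeologicalSpace.locality fun x => ?_
  obtain ⟨q, hq, hpq⟩ := hp x
  obtain ⟨u, hu, huo, hxu⟩ := eventually_nhds_iff.mp hpq
  refine ⟨u, huo, hxu, fun {l f} hf hfs => ?_⟩
  have : p ∘ f = q ∘ f := funext fun y => hu _ (hf y)
  rw [this]
  exact isPlot_reparam hq hfs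

theorem isPlot_subtype_iff {r : X → Prop} {k : ℕ} {p : EuclideanSpace ℝ (Fin k) → Subtype r} :
    IsPlot p ↔ IsPlot fun y => (p y : X) :=
  ⟨fun h => h (), fun h _ => h⟩

theorem dSmooth_val {r : X → Prop} : DSmooth (Subtype.val : Subtype r → X) :=
  fun _ _ hp => isPlot_subtype_iff.mp hp

theorem _root_.Diffeology.DSmooth.subtype_mk {r : Y → Prop} {f : X → Y} (hf : DSmooth f) (h : ∀ x, r (f x)) :
    DSmooth fun x => (⟨f x, h x⟩ : Subtype r) :=
  fun _ _ hp => isPlot_subtype_iff.mpr (hf _ _ hp)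

theorem dSmooth_fst : DSmooth (Prod.fst : X × Y → X) := fun _ _ hp => hp.1

theorem dSmooth_snd : DSmooth (Prod.snd : X × Y → Y) := fun _ _ hp => hp.2

theorem _root_.Diffeology.DSmooth.prodMk {f : X → Y} {g : X → Z} (hf : DSmooth f) (hg : DSmooth g) :
    DSmooth fun x => (f x, g x) :=
  fun _ _ hp => ⟨hf _ _ hp, hg _ _ hp⟩

theorem dSmooth_quotientMk (s : Setoid X) : DSmooth (Quotient.mk s) :=
  fun _ p hp _ => ⟨p, hp, Filter.EventuallyEq.rfl⟩

/-- A plot of a quotient lifts locally to a plot. -/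
theorem exists_lift_quotient {s : Setoid X} {k : ℕ} {p : EuclideanSpace ℝ (Fin k) → Quotient s}
    (hp : IsPlot p) (x : EuclideanSpace ℝ (Fin k)) :
    ∃ q : EuclideanSpace ℝ (Fin k) → X, IsPlot q ∧ ∀ᶠ y in 𝓝 x, p y = Quotient.mk s (q y) :=
  hp x

/-- A plot which satisfies a condition near a point can be replaced by one which satisfies it
everywhere, without changing it near the point. -/
theorem exists_isPlot_forall {r : X → Prop} {k : ℕ} {q : EuclideanSpace ℝ (Fin k) → X}
    (hq : IsPlot q) {x : EuclideanSpace ℝ (Fin k)} (hr : ∀ᶠ y in 𝓝 x, r (q y)) :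
    ∃ q' : EuclideanSpace ℝ (Fin k) → X, IsPlot q' ∧ (∀ y, r (q' y)) ∧ ∀ᶠ y in 𝓝 x, q' y = q y := by
  obtain ⟨u, hu, huo, hxu⟩ := eventually_nhds_iff.mp hr
  obtain ⟨f, hf, hfu, -, hfe⟩ := exists_smooth_cutoff huo hxu
  refine ⟨q ∘ f, isPlot_reparam hq hf, fun y => hu _ (hfu y), ?_⟩
  filter_upwards [hfe] with y hy
  simp [hy]

/-- Preimages of D-open sets under plots are open, so near each point a plot stays in one of the
given sets, and a cutoff makes it stay there everywhere. -/
theorem dSmooth_of_locally {f : X → Y} (h : ∀ x, ∃ U : Set X, IsOpen[dTopology] U ∧ x ∈ U ∧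
    DSmooth fun u : U => f u) : DSmooth f := by
  intro k p hp
  refine isPlot_of_eventuallyEq fun x => ?_
  obtain ⟨U, hU, hxU, hf⟩ := h (p x)
  have hev : ∀ᶠ y in 𝓝 x, p y ∈ U := (isOpen_iff_preimages_plots.mp hU k p hp).mem_nhds hxU
  obtain ⟨q, hq, hqU, hqp⟩ := exists_isPlot_forall hp hev
  refine ⟨fun y => f (q y), hf k (fun y => ⟨q y, hqU y⟩) (isPlot_subtype_iff.mpr hq), ?_⟩
  filter_upwards [hqp] with y hy
  simp [hy]

/-- Inverses are rarely given by a formula here. It is enough that plots of the target lift locally,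
which is what quotients and submersions provide. -/
theorem dSmooth_symm_of_lift {e : X ≃ Y} (h : ∀ (k : ℕ) (p : EuclideanSpace ℝ (Fin k) → Y),
    IsPlot p → ∀ x, ∃ q : EuclideanSpace ℝ (Fin k) → X, IsPlot q ∧ ∀ᶠ y in 𝓝 x, p y = e (q y)) :
    DSmooth e.symm := by
  intro k p hp
  refine isPlot_of_eventuallyEq fun x => ?_
  obtain ⟨q, hq, hpq⟩ := h k p hp x
  refine ⟨q, hq, ?_⟩
  filter_upwards [hpq] with y hy
  simp [hy]

theorem _root_.Diffeology.DSmooth.isOpen_preimage {f : X → Y} (hf : DSmooth f) {U : Set Y}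
    (hU : IsOpen[dTopology] U) : IsOpen[dTopology] (f ⁻¹' U) :=
  isOpen_iff_preimages_plots.mpr fun k _ hp =>
    isOpen_iff_preimages_plots.mp hU k _ (hf k _ hp)

theorem isOpen_dTopology_inter {U V : Set X} (hU : IsOpen[dTopology] U)
    (hV : IsOpen[dTopology] V) : IsOpen[dTopology] (U ∩ V) :=
  @IsOpen.inter X dTopology _ _ hU hV

end Diffeological

/-! ### Smoothness of linear maps and of algebra multiplication -/

section VectorSpaces

variable {V W : Type*} [AddCommGroup V] [Module ℝ V] [AddCommGroup W] [Module ℝ W]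

/-- Linear maps are smooth. -/
theorem dSmooth_linearMap (f : V →ₗ[ℝ] W) :
    @DSmooth _ _ (vectorDiffeology V) (vectorDiffeology W) f := by
  intro k p hp x
  obtain ⟨N, w, c, hc, h⟩ := hp x
  refine ⟨N, fun i => f (w i), c, hc, ?_⟩
  filter_upwards [h] with y hy
  simp [hy]

/-- Linear functionals of plots are smooth, hence continuous. -/
theorem continuous_linearMap_comp_plot (f : V →ₗ[ℝ] ℝ) {k : ℕ}
    {p : EuclideanSpace ℝ (Fin k) → V} (hp : @IsPlot _ (vectorDiffeology V) _ p) :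
    Continuous fun y => f (p y) := by
  refine continuous_iff_continuousAt.mpr fun x => ?_
  obtain ⟨N, w, c, hc, h⟩ := hp x
  have h1 : (fun y => f (p y)) =ᶠ[𝓝 x] fun y => ∑ i, c i y * f (w i) := by
    filter_upwards [h] with y hy
    simp [hy]
  refine ContinuousAt.congr ?_ h1.symm
  exact (continuous_finsetSum _ fun i _ => (hc i).continuous.mul continuous_const).continuousAt

/-- Multiplication of a real algebra is smooth. -/
theorem isPlot_mul {A : Type*} [Ring A] [Algebra ℝ A] {k : ℕ}
    {p q : EuclideanSpace ℝ (Fin k) → A} (hp : @IsPlot _ (vectorDiffeology A) _ p)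
    (hq : @IsPlot _ (vectorDiffeology A) _ q) :
    @IsPlot _ (vectorDiffeology A) _ fun y => p y * q y := by
  intro x
  obtain ⟨N, w, c, hc, h⟩ := hp x
  obtain ⟨N', w', c', hc', h'⟩ := hq x
  -- The product of the two local expansions is a sum over pairs of indices, renumbered by a single
  -- `Fin`.
  let e := (Fintype.equivFin (Fin N × Fin N')).symm
  refine ⟨_, fun i => w (e i).1 * w' (e i).2, fun i y => c (e i).1 y * c' (e i).2 y,
    fun i => (hc _).mul (hc' _), ?_⟩
  filter_upwards [h, h'] with y hy hy'
  rw [hy, hy', e.sum_comp fun j : Fin N × Fin N' => (c j.1 y * c' j.2 y) • (w j.1 * w' j.2),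
    Finset.sum_mul_sum, Fintype.sum_prod_type]
  simp only [smul_mul_smul_comm]

end VectorSpaces

theorem isPlot_units_iff {A : Type*} [Ring A] [DiffeologicalSpace A] {k : ℕ} {p : EuclideanSpace ℝ (Fin k) → Aˣ} :
    @IsPlot _ (unitsDiffeology A) _ p ↔
      IsPlot (fun y => (p y : A)) ∧ IsPlot fun y => (((p y)⁻¹ : Aˣ) : A) :=
  ⟨fun h => h (), fun h _ => h⟩

/-! ### The kernel of `ζ` and the inclusion of the real Clifford algebra -/

section RealClifford

variable (m n : ℕ)

/-- The standard generators of the real Clifford algebra. -/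
def basisVec (i : Fin n) : RealClifford m n := CliffordAlgebra.ι (form m n) (Pi.single i 1)

/-- The squares of the standard generators. -/
def basisSign (i : Fin n) : ℝ := if (i : ℕ) < m then 1 else -1

theorem basisSign_mul_self (i : Fin n) : basisSign m n i * basisSign m n i = 1 := by
  unfold basisSign; split_ifs <;> norm_num

theorem form_single (i : Fin n) (c : ℝ) :
    form m n (Pi.single i c) = basisSign m n i * (c * c) := by
  rw [form, QuadraticMap.weightedSumSquares_apply, Finset.sum_eq_single i]
  · simp [basisSign]
  · intro j _ hj
    simp [hj]
  · simp

theorem basisVec_mul_self (i : Fin n) :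
    basisVec m n i * basisVec m n i = algebraMap ℝ _ (basisSign m n i) := by
  rw [basisVec, CliffordAlgebra.ι_sq_scalar, form_single]
  simp

theorem basisVec_mul_basisVec {i j : Fin n} (hij : i ≠ j) :
    basisVec m n i * basisVec m n j = -(basisVec m n j * basisVec m n i) := by
  refine eq_neg_of_add_eq_zero_left (CliffordAlgebra.ι_mul_ι_add_swap_of_isOrtho ?_)
  simp only [QuadraticMap.isOrtho_def, form, QuadraticMap.weightedSumSquares_apply,
    ← Finset.sum_add_distrib]
  refine Finset.sum_congr rfl fun k _ => ?_
  by_cases hk : k = i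
  · subst hk; simp [hij]
  · simp [Pi.single_eq_of_ne hk]

/-- Products of standard generators. -/
def monomialOf (l : List (Fin n)) : RealClifford m n := (l.map (basisVec m n)).prod

/-- Passing a letter different from `i` costs a sign and passing the letter `i` costs none. The
exponent is therefore the length minus the count, which has the parity of their sum. -/
theorem basisVec_mul_monomialOf (i : Fin n) (l : List (Fin n)) :
    basisVec m n i * monomialOf m n l =
      (-1 : ℝ) ^ (l.length + l.count i) • (monomialOf m n l * basisVec m n i) := by
  induction l with
  | nil => simp [monomialOf]
  | cons j l ih =>
    have hc : monomialOf m n (j :: l) = basisVec m n j * monomialOf m n l := by simp [monomialOf]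
    by_cases hij : i = j
    · subst hij
      have hs : (-1 : ℝ) ^ (l.length + 1 + (l.count i + 1)) = (-1) ^ (l.length + l.count i) := by
        ring
      rw [hc, List.count_cons_self, List.length_cons, hs]
      conv_lhs => rw [ih, mul_smul_comm, ← mul_assoc]
    · rw [hc, ← mul_assoc, basisVec_mul_basisVec m n hij, neg_mul, mul_assoc, ih, mul_smul_comm, ← mul_assoc,
        List.count_cons_of_ne (Ne.symm hij), List.length_cons, ← neg_smul]
      congr 1
      ring

/-- Words are closed under concatenation, so their span is a subalgebra containing the generators.
Words may be unordered with repetitions; no basis of the Clifford algebra is needed. -/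
theorem span_monomialOf : Submodule.span ℝ (Set.range (monomialOf m n)) = ⊤ := by
  refine top_unique fun a _ => ?_
  have hmul : ∀ x ∈ Submodule.span ℝ (Set.range (monomialOf m n)),
      ∀ y ∈ Submodule.span ℝ (Set.range (monomialOf m n)),
      x * y ∈ Submodule.span ℝ (Set.range (monomialOf m n)) := by
    intro x hx y hy
    have h := Submodule.mul_mem_mul hx hy
    rw [Submodule.span_mul_span] at h
    refine Submodule.span_mono ?_ h
    rintro _ ⟨_, ⟨l, rfl⟩, _, ⟨l', rfl⟩, rfl⟩
    exact ⟨l ++ l', by simp [monomialOf]⟩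
  have hone : (1 : RealClifford m n) ∈ Submodule.span ℝ (Set.range (monomialOf m n)) :=
    Submodule.subset_span ⟨[], by simp [monomialOf]⟩
  induction a using CliffordAlgebra.induction with
  | algebraMap r =>
    rw [Algebra.algebraMap_eq_smul_one]
    exact Submodule.smul_mem _ _ hone
  | ι v =>
    rw [pi_eq_sum_univ' v, map_sum]
    refine Submodule.sum_mem _ fun i _ => ?_
    rw [map_smul]
    refine Submodule.smul_mem _ _ (Submodule.subset_span ⟨[i], ?_⟩)
    simp only [monomialOf, basisVec, List.map_cons, List.map_nil, List.prod_singleton]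
  | mul x y hx hy => exact hmul x (hx trivial) y (hy trivial)
  | add x y hx hy => exact Submodule.add_mem _ (hx trivial) (hy trivial)

/-- The first letter must occur again. Moving it up to its next copy cancels both up to sign and
leaves a shorter word with even counts. -/
theorem monomialOf_mem_span_one (l : List (Fin n)) (hl : ∀ i, Even (l.count i)) :
    monomialOf m n l ∈ Submodule.span ℝ {(1 : RealClifford m n)} := by
  induction hk : l.length using Nat.strong_induction_on generalizing l with
  | _ k ih =>
    cases l with
    | nil => simp [monomialOf, Submodule.mem_span_singleton_self]
    | cons i l =>
      have hi : i ∈ l := by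
        have h1 := hl i
        rw [List.count_cons_self] at h1
        refine List.count_pos_iff.mp (Nat.pos_of_ne_zero fun h0 => ?_)
        simp [h0] at h1
      obtain ⟨a, b, rfl⟩ := List.append_of_mem hi
      have hlt : (a ++ b).length < k := by
        rw [← hk]; simp
      have hab := ih _ hlt (a ++ b) (fun j => by
        have h1 := hl j
        simp only [List.count_cons, List.count_append] at h1 ⊢
        split_ifs at h1 <;> grind) rfl
      have h2 : monomialOf m n (i :: (a ++ i :: b)) =
          ((-1 : ℝ) ^ (a.length + a.count i) * basisSign m n i) • monomialOf m n (a ++ b) := by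
        have e1 : monomialOf m n (i :: (a ++ i :: b)) =
            basisVec m n i * monomialOf m n a * (basisVec m n i * monomialOf m n b) := by
          simp [monomialOf, mul_assoc]
        have e2 : monomialOf m n (a ++ b) = monomialOf m n a * monomialOf m n b := by
          simp [monomialOf]
        rw [e1, e2, basisVec_mul_monomialOf, smul_mul_assoc, mul_smul]
        congr 1
        rw [mul_assoc, ← mul_assoc (basisVec m n i), basisVec_mul_self, ← Algebra.smul_def,
          mul_smul_comm]
      rw [h2]
      exact Submodule.smul_mem _ _ hab

/-- In even dimension the centre of the real Clifford algebra consists of the scalars. -/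
theorem exists_algebraMap_of_commute (hn : Even n) (a : RealClifford m n)
    (ha : ∀ v, a * CliffordAlgebra.ι (form m n) v = CliffordAlgebra.ι (form m n) v * a) :
    ∃ c : ℝ, a = algebraMap ℝ _ c := by
  -- The words of `S I` are those commuting with every generator of index in `I`.
  let S (I : Finset (Fin n)) : Set (RealClifford m n) :=
    monomialOf m n '' {l | ∀ i ∈ I, Even (l.length + l.count i)}
  have key : ∀ I, a ∈ Submodule.span ℝ (S I) := by
    intro I
    induction I using Finset.induction_on with
    | empty => simp [S, span_monomialOf]
    | insert i I _ ih =>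
      -- As `basisSign i • eᵢ` is the inverse of `eᵢ`, this averages `x` with its conjugate by `eᵢ`.
      -- It fixes `a` and the words commuting with `eᵢ`, and kills those anticommuting with it, so
      -- linear independence of the words is not required.
      let T : RealClifford m n →ₗ[ℝ] RealClifford m n := (2⁻¹ : ℝ) • (LinearMap.id +
        basisSign m n i • (LinearMap.mulLeft ℝ (basisVec m n i) ∘ₗ
          LinearMap.mulRight ℝ (basisVec m n i)))
      have hT : ∀ x, T x = (2⁻¹ : ℝ) •
        (x + basisSign m n i • (basisVec m n i * (x * basisVec m n i))) := fun x => rfl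
      have hTa : T a = a := by
        rw [hT, basisVec, ha, ← basisVec, ← mul_assoc, basisVec_mul_self, ← Algebra.smul_def,
          smul_smul, basisSign_mul_self, one_smul, ← two_smul ℝ, smul_smul]
        norm_num
      have hle : Submodule.span ℝ (S I) ≤ (Submodule.span ℝ (S (insert i I))).comap T := by
        refine Submodule.span_le.mpr ?_
        rintro _ ⟨l, hl, rfl⟩
        have hTl : T (monomialOf m n l) =
            (2⁻¹ * (1 + (-1 : ℝ) ^ (l.length + l.count i))) • monomialOf m n l := by
          rw [hT, ← mul_assoc, basisVec_mul_monomialOf, smul_mul_assoc, mul_assoc,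
            basisVec_mul_self, ← Algebra.commutes, ← Algebra.smul_def, smul_smul, smul_smul,
            mul_comm _ (basisSign m n i), ← mul_assoc, basisSign_mul_self, one_mul, mul_smul,
            add_smul, one_smul]
        simp only [Submodule.comap_coe, Set.mem_preimage, SetLike.mem_coe, hTl]
        rcases Nat.even_or_odd (l.length + l.count i) with h | h
        · refine Submodule.smul_mem _ _ (Submodule.subset_span ⟨l, ?_, rfl⟩)
          intro j hj
          rcases Finset.mem_insert.mp hj with rfl | hj
          exacts [h, hl j hj]
        · simp [h.neg_one_pow]
      exact hTa ▸ hle ih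
  have hle : Submodule.span ℝ (S Finset.univ) ≤ Submodule.span ℝ {(1 : RealClifford m n)} := by
    refine Submodule.span_le.mpr ?_
    rintro _ ⟨l, hl, rfl⟩
    have hsum : ∀ l : List (Fin n), ∑ i, l.count i = l.length := fun l => by
      induction l with
      | nil => simp
      | cons j l ih => simp [List.count_cons, Finset.sum_add_distrib, ih]
    -- Summing the parity conditions over all `i` gives `n * length + length` even. Here `n` even
    -- forces the length, and then every count, to be even.
    have hlen : Even l.length := by
      have h1 : Even (∑ i : Fin n, (l.length + l.count i)) :=
        Finset.even_sum _ fun i hi => hl i hi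
      rw [Finset.sum_add_distrib, hsum] at h1
      simp only [Finset.sum_const, Finset.card_univ, Fintype.card_fin, smul_eq_mul] at h1
      exact (Nat.even_add.mp h1).mp (hn.mul_right _)
    exact monomialOf_mem_span_one m n l fun i =>
      (Nat.even_add.mp (hl i (Finset.mem_univ i))).mp hlen
  obtain ⟨c, hc⟩ := Submodule.mem_span_singleton.mp (hle (key _))
  exact ⟨c, by rw [← hc, Algebra.algebraMap_eq_smul_one]⟩

/-! ### The reversal norm on the Pin group and the kernel of `ζ` -/

variable {m n}

/-- A generator is fixed by reversal and squares to `±1`. In a product the inner norm is a central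
sign, so it can be pulled out. -/
theorem mul_reverse_of_mem_pin {u : (RealClifford m n)ˣ} (hu : u ∈ pin m n) :
    (u : RealClifford m n) * CliffordAlgebra.reverse (u : RealClifford m n) = 1 ∨
      (u : RealClifford m n) * CliffordAlgebra.reverse (u : RealClifford m n) = -1 := by
  induction hu using Subgroup.closure_induction with
  | mem u hu =>
    obtain ⟨v, hv, h⟩ := hu
    rw [hv, CliffordAlgebra.reverse_ι, CliffordAlgebra.ι_sq_scalar]
    rcases h with h | h <;> simp [h]
  | one => simp
  | mul x y _ _ hx hy =>
    simp only [Units.val_mul, CliffordAlgebra.reverse.map_mul]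
    have : (x : RealClifford m n) * y * (CliffordAlgebra.reverse (y : RealClifford m n) *
        CliffordAlgebra.reverse (x : RealClifford m n)) =
        x * (y * CliffordAlgebra.reverse (y : RealClifford m n)) *
        CliffordAlgebra.reverse (x : RealClifford m n) := by simp only [mul_assoc]
    rw [this]
    rcases hx with hx | hx <;> rcases hy with hy | hy <;> simp [hx, hy]
  | inv x _ hx =>
    have h1 : CliffordAlgebra.reverse (x : RealClifford m n) *
        CliffordAlgebra.reverse ((x⁻¹ : (RealClifford m n)ˣ) : RealClifford m n) = 1 := by
      rw [← CliffordAlgebra.reverse.map_mul, Units.inv_mul, CliffordAlgebra.reverse.map_one]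
    rcases hx with hx | hx
    · left
      calc _ = ((x⁻¹ : (RealClifford m n)ˣ) : RealClifford m n) *
          ((x * CliffordAlgebra.reverse (x : RealClifford m n)) *
          CliffordAlgebra.reverse ((x⁻¹ : (RealClifford m n)ˣ) : RealClifford m n)) := by
            rw [hx, one_mul]
        _ = 1 := by rw [mul_assoc, h1, mul_one, Units.inv_mul]
    · right
      calc _ = -(((x⁻¹ : (RealClifford m n)ˣ) : RealClifford m n) *
          ((x * CliffordAlgebra.reverse (x : RealClifford m n)) *
          CliffordAlgebra.reverse ((x⁻¹ : (RealClifford m n)ˣ) : RealClifford m n))) := by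
            rw [hx]; simp
        _ = -1 := by rw [mul_assoc, h1, mul_one, Units.inv_mul]

/-- For a standard unit vector `e`, the element `-e⁻¹` is again a unit vector, and `e * (-e⁻¹) =
-1`. Positive dimension supplies `e`. -/
theorem neg_one_mem_pin (hn0 : 0 < n) : (-1 : (RealClifford m n)ˣ) ∈ pin m n := by
  let i : Fin n := ⟨0, hn0⟩
  have hs : basisSign m n i = 1 ∨ basisSign m n i = -1 := by
    unfold basisSign; split_ifs <;> simp
  have hsq : basisVec m n i * (basisSign m n i • basisVec m n i) = 1 := by
    rw [mul_smul_comm, basisVec_mul_self, Algebra.smul_def, ← map_mul, basisSign_mul_self, map_one]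
  let x : (RealClifford m n)ˣ := ⟨basisVec m n i, basisSign m n i • basisVec m n i, hsq, by
    rw [smul_mul_assoc, ← mul_smul_comm, hsq]⟩
  have hx : x ∈ pin m n :=
    Subgroup.subset_closure ⟨Pi.single i 1, rfl, by simpa [form_single] using hs⟩
  have hy : -x⁻¹ ∈ pin m n := by
    refine Subgroup.subset_closure ⟨Pi.single i (-basisSign m n i), ?_, ?_⟩
    · have : (Pi.single i (-basisSign m n i) : Fin n → ℝ) =
          (-basisSign m n i) • Pi.single i 1 := by
        rw [← Pi.single_smul]; simp
      rw [this, map_smul, neg_smul]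
      rfl
    · simpa [form_single, basisSign_mul_self] using hs
  have := mul_mem hx hy
  rwa [mul_neg, mul_inv_cancel] at this

/-- The kernel of `ζ` consists of `1` and `-1`. -/
theorem eq_one_or_eq_neg_one_of_zeta_eq_one (hn : Even n) {g : Pin m n} (hg : zeta m n g = 1) :
    (g : (RealClifford m n)ˣ) = 1 ∨ (g : (RealClifford m n)ˣ) = -1 := by
  -- Acting trivially by conjugation means commuting with all vectors, so `g` is a real scalar. A
  -- scalar is its own reverse, whence `c * c = ±1`, and `-1` is not a real square.
  obtain ⟨c, hc⟩ := exists_algebraMap_of_commute m n hn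
    ((g : (RealClifford m n)ˣ) : RealClifford m n) fun v => by
      have h1 : zetaFun m n g v = v := congrArg (fun A : Orth m n => A.1 v) hg
      have h2 := ι_zetaFun m n g v
      rw [h1] at h2
      conv_rhs => rw [h2]
      rw [Units.inv_mul_cancel_right]
  have hinj := (algebraMap ℝ (RealClifford m n)).injective
  have h1 := mul_reverse_of_mem_pin g.2
  rw [hc, CliffordAlgebra.reverse.commutes, ← map_mul] at h1
  have h2 : c * c = 1 ∨ c * c = -1 := by
    refine h1.imp (fun h => hinj (by rw [h, map_one])) fun h => hinj (by rw [h, map_neg, map_one])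
  have h3 : c = 1 ∨ c = -1 := by
    rcases h2 with h | h
    · exact mul_self_eq_one_iff.mp h
    · nlinarith [mul_self_nonneg c]
  refine h3.imp (fun h => Units.ext ?_) fun h => Units.ext ?_
  · rw [hc, h]; simp
  · rw [hc, h]; simp

theorem zeta_neg_one (hn0 : 0 < n) : zeta m n ⟨-1, neg_one_mem_pin hn0⟩ = 1 := by
  refine Subtype.ext (LinearEquiv.ext fun v => ι_injective m n ?_)
  refine (ι_zetaFun m n _ v).trans ?_
  simp

/-! ### Injectivity of the inclusion into the complex Clifford algebra -/

/-- The inverse of the complexified inclusion of the real Clifford algebra, on generators. -/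
noncomputable def cogenerators (m n : ℕ) : (Fin n → ℝ) →ₗ[ℝ] ℂ ⊗[ℝ] RealClifford m n :=
  TensorProduct.mk ℝ ℂ (RealClifford m n) 1 ∘ₗ CliffordAlgebra.ι (form m n) ∘ₗ firstCoords m n -
    TensorProduct.mk ℝ ℂ (RealClifford m n) Complex.I ∘ₗ CliffordAlgebra.ι (form m n) ∘ₗ
      (LinearMap.id - firstCoords m n)

/-- The factor `-i` squares to `-1` and undoes the negative signs of `form m n` on the last
coordinates. The cross terms cancel because the two coordinate blocks are orthogonal. -/
theorem cogenerators_sq (m n : ℕ) (v : Fin n → ℝ) :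
    cogenerators m n v * cogenerators m n v =
      algebraMap ℝ (ℂ ⊗[ℝ] RealClifford m n) (form n n v) := by
  set a := firstCoords m n v with ha
  set b := v - firstCoords m n v with hb
  have hab : CliffordAlgebra.ι (form m n) a * CliffordAlgebra.ι (form m n) b +
      CliffordAlgebra.ι (form m n) b * CliffordAlgebra.ι (form m n) a = 0 := by
    refine CliffordAlgebra.ι_mul_ι_add_swap_of_isOrtho ?_
    simp only [QuadraticMap.isOrtho_def, form, QuadraticMap.weightedSumSquares_apply, ha, hb,
      firstCoords, ← Finset.sum_add_distrib]
    refine Finset.sum_congr rfl fun i _ => ?_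
    by_cases h : (i : ℕ) < m <;> simp [h]
  have hQ : form n n v = form m n a - form m n b := by
    simp only [form, QuadraticMap.weightedSumSquares_apply, ha, hb, firstCoords,
      ← Finset.sum_sub_distrib]
    refine Finset.sum_congr rfl fun i _ => ?_
    by_cases h : (i : ℕ) < m <;> simp [h]
  have hv : cogenerators m n v = (1 : ℂ) ⊗ₜ[ℝ] CliffordAlgebra.ι (form m n) a -
      Complex.I ⊗ₜ[ℝ] CliffordAlgebra.ι (form m n) b := by
    simp [cogenerators, ha, hb]
  rw [hv, hQ, sub_mul, mul_sub, mul_sub]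
  simp only [Algebra.TensorProduct.tmul_mul_tmul, one_mul, mul_one, Complex.I_mul_I,
    CliffordAlgebra.ι_sq_scalar]
  have h2 : Complex.I ⊗ₜ[ℝ] (CliffordAlgebra.ι (form m n) a * CliffordAlgebra.ι (form m n) b) +
      Complex.I ⊗ₜ[ℝ] (CliffordAlgebra.ι (form m n) b * CliffordAlgebra.ι (form m n) a) =
      (0 : ℂ ⊗[ℝ] RealClifford m n) := by
    rw [← TensorProduct.tmul_add, hab, TensorProduct.tmul_zero]
  have h3 : ∀ r : ℝ, (1 : ℂ) ⊗ₜ[ℝ] (algebraMap ℝ (RealClifford m n) r) =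
      algebraMap ℝ (ℂ ⊗[ℝ] RealClifford m n) r := fun r => by
    rw [Algebra.algebraMap_eq_smul_one, TensorProduct.tmul_smul, Algebra.algebraMap_eq_smul_one,
      Algebra.TensorProduct.one_def]
  clear_value a b
  rw [TensorProduct.neg_tmul, h3, h3, map_sub]
  rw [eq_neg_of_add_eq_zero_right h2]
  abel

/-- The real Clifford algebra is a subring of the complex one. -/
theorem realIncl_injective (m n : ℕ) : Function.Injective (realIncl m n) := by
  -- Sending the last generators to `-i eᵏ` reverses `eᵏ ↦ i eᵏ`, as `i * (-i) = 1`. The complex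
  -- extension `J` then satisfies `J ∘ realIncl = (1 ⊗ ·)`, which is injective.
  let j : RealClifford n n →ₐ[ℝ] ℂ ⊗[ℝ] RealClifford m n :=
    CliffordAlgebra.lift (form n n) ⟨cogenerators m n, cogenerators_sq m n⟩
  let i : ℂ →ₐ[ℝ] ℂ ⊗[ℝ] RealClifford m n := Algebra.TensorProduct.includeLeft
  let J : ComplexClifford n →ₐ[ℝ] ℂ ⊗[ℝ] RealClifford m n :=
    Algebra.TensorProduct.lift i j fun x y => by
      rw [commute_iff_eq]
      change x ⊗ₜ[ℝ] (1 : RealClifford m n) * j y = j y * x ⊗ₜ[ℝ] 1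
      induction j y using TensorProduct.induction_on with
      | zero => simp
      | tmul a b => simp [mul_comm]
      | add a b ha hb => rw [mul_add, add_mul, ha, hb]
  have hJ : J.comp (realIncl m n) = Algebra.TensorProduct.includeRight := by
    refine CliffordAlgebra.hom_ext (LinearMap.ext fun v => ?_)
    have hff : ∀ w, firstCoords m n (firstCoords m n w) = firstCoords m n w := fun w => by
      ext k
      by_cases h : (k : ℕ) < m <;> simp [firstCoords, h]
    have h1 : realIncl m n (CliffordAlgebra.ι (form m n) v) = generators m n v :=
      CliffordAlgebra.lift_ι_apply _ _ _
    have hj : ∀ w, j (CliffordAlgebra.ι (form n n) w) = cogenerators m n w := fun w =>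
      CliffordAlgebra.lift_ι_apply _ _ _
    have h2 : generators m n v = (1 : ℂ) ⊗ₜ[ℝ] CliffordAlgebra.ι (form n n) (firstCoords m n v) +
      Complex.I ⊗ₜ[ℝ] CliffordAlgebra.ι (form n n) (v - firstCoords m n v) := by
      simp [generators]
    have hJt : ∀ c w, J (c ⊗ₜ[ℝ] CliffordAlgebra.ι (form n n) w) =
        c ⊗ₜ[ℝ] (1 : RealClifford m n) * cogenerators m n w := fun c w => by
      rw [← hj]; exact Algebra.TensorProduct.lift_tmul _ _ _ _ _
    change J (realIncl m n (CliffordAlgebra.ι (form m n) v)) =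
      (1 : ℂ) ⊗ₜ[ℝ] CliffordAlgebra.ι (form m n) v
    have hc1 : cogenerators m n (firstCoords m n v) =
        (1 : ℂ) ⊗ₜ[ℝ] CliffordAlgebra.ι (form m n) (firstCoords m n v) := by
      simp [cogenerators, hff]
    have hc2 : cogenerators m n (v - firstCoords m n v) =
        (-Complex.I) ⊗ₜ[ℝ] CliffordAlgebra.ι (form m n) (v - firstCoords m n v) := by
      simp [cogenerators, hff, TensorProduct.neg_tmul]
    rw [h1, h2, map_add, hJt, hJt, hc1, hc2, Algebra.TensorProduct.tmul_mul_tmul,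
      Algebra.TensorProduct.tmul_mul_tmul, mul_neg, Complex.I_mul_I, neg_neg, one_mul, one_mul,
      one_mul, ← TensorProduct.tmul_add, ← map_add, add_sub_cancel]
  have hinj : Function.Injective
      (Algebra.TensorProduct.includeRight : RealClifford m n →ₐ[ℝ] ℂ ⊗[ℝ] RealClifford m n) :=
    Algebra.TensorProduct.includeRight_injective (algebraMap ℝ ℂ).injective
  rw [← hJ, AlgHom.coe_comp] at hinj
  exact hinj.of_comp

end RealClifford

/-! ### Smoothness of the group operations and of the actions -/

section Smooth

variable {m n : ℕ}

theorem isPlot_pin_iff {k : ℕ} {p : EuclideanSpace ℝ (Fin k) → Pin m n} :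
    IsPlot p ↔ IsPlot (fun y => ((p y : (RealClifford m n)ˣ) : RealClifford m n)) ∧
      IsPlot fun y => (((p y : (RealClifford m n)ˣ)⁻¹ : (RealClifford m n)ˣ) : RealClifford m n) :=
  isPlot_subtype_iff.trans isPlot_units_iff

theorem _root_.Diffeology.IsPlot.pin_mul {k : ℕ} {p q : EuclideanSpace ℝ (Fin k) → Pin m n} (hp : IsPlot p)
    (hq : IsPlot q) : IsPlot fun y => p y * q y := by
  rw [isPlot_pin_iff] at *
  refine ⟨isPlot_mul hp.1 hq.1, ?_⟩
  simpa using isPlot_mul hq.2 hp.2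

theorem _root_.Diffeology.IsPlot.pin_inv {k : ℕ} {p : EuclideanSpace ℝ (Fin k) → Pin m n} (hp : IsPlot p) :
    IsPlot fun y => (p y)⁻¹ := by
  rw [isPlot_pin_iff] at *
  simpa using hp.symm

theorem dSmooth_realIncl : DSmooth (realIncl m n) :=
  dSmooth_linearMap (realIncl m n).toLinearMap

theorem dSmooth_pinToGCC : DSmooth (pinToGCC m n) := by
  intro k p hp
  rw [isPlot_pin_iff] at hp
  refine isPlot_units_iff.mpr ⟨dSmooth_realIncl _ _ hp.1, ?_⟩
  exact dSmooth_realIncl _ _ hp.2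

theorem dSmooth_smul_complexClifford :
    DSmooth fun q : GCC n × ComplexClifford n => q.1 • q.2 :=
  fun _ _ hp => isPlot_mul (isPlot_units_iff.mp hp.1).1 hp.2

theorem dSmooth_smul_ideal (Ψ : Ideal (ComplexClifford n)) :
    DSmooth fun q : GCC n × Ψ => q.1 • q.2 :=
  fun _ _ hp => isPlot_subtype_iff.mpr
    (isPlot_mul (isPlot_units_iff.mp hp.1).1 (isPlot_subtype_iff.mp hp.2))

/-- A plot of the Pin group with values in `{1, -1}` is locally constant. -/
theorem eventually_eq_of_isPlot_pin {k : ℕ} {p : EuclideanSpace ℝ (Fin k) → Pin m n}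
    (hp : IsPlot p) (h : ∀ y, (p y : (RealClifford m n)ˣ) = 1 ∨ (p y : (RealClifford m n)ˣ) = -1)
    (x : EuclideanSpace ℝ (Fin k)) : ∀ᶠ y in 𝓝 x, p y = p x := by
  -- A linear functional with `f 1 = 1` separates `1` from `-1` and is continuous along plots.
  obtain ⟨f, hf⟩ := LinearMap.exists_leftInverse_of_injective
    (Algebra.linearMap ℝ (RealClifford m n))
    (LinearMap.ker_eq_bot.mpr (algebraMap ℝ (RealClifford m n)).injective)
  have hf1 : f 1 = 1 := by simpa using LinearMap.congr_fun hf 1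
  have hval : ∀ y, (p y : (RealClifford m n)ˣ) = 1 ∧
      f ((p y : (RealClifford m n)ˣ) : RealClifford m n) = 1 ∨
      (p y : (RealClifford m n)ˣ) = -1 ∧
      f ((p y : (RealClifford m n)ˣ) : RealClifford m n) = -1 := fun y =>
    (h y).imp (fun e => ⟨e, by simp [e, hf1]⟩) fun e => ⟨e, by simp [e, hf1]⟩
  have hc := continuous_linearMap_comp_plot f (isPlot_pin_iff.mp hp).1
  -- The values `1` and `-1` of the functional are at distance 2, so closeness within 1 forces
  -- equality.
  filter_upwards [Metric.continuousAt_iff'.mp hc.continuousAt 1 one_pos] with y hy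
  rw [Real.dist_eq, abs_lt] at hy
  refine Subtype.ext ?_
  rcases hval x with ⟨e, e'⟩ | ⟨e, e'⟩ <;> rcases hval y with ⟨d, d'⟩ | ⟨d, d'⟩ <;>
    first | exact d.trans e.symm | (exfalso; rw [d', e'] at hy; linarith [hy.1, hy.2])

end Smooth

/-! ### Fibre bundles and principal bundles -/

section Bundles

variable {E B : Type*} [DiffeologicalSpace E] [DiffeologicalSpace B]

/-- Local triviality from local parametrizations through which plots lift locally. -/
theorem isFibreBundle_of_local {F : Type*} [DiffeologicalSpace F] {π : E → B} (hπ : DSmooth π)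
    (h : ∀ b, ∃ U : Set B, IsOpen[dTopology] U ∧ b ∈ U ∧ ∃ φ : U × F → E, DSmooth φ ∧
      (∀ q, π (φ q) = q.1) ∧ (∀ u v v', φ (u, v) = φ (u, v') → v = v') ∧
      ∀ (k : ℕ) (p : EuclideanSpace ℝ (Fin k) → E), IsPlot p → ∀ hp : ∀ y, π (p y) ∈ U, ∀ x,
        ∃ v : EuclideanSpace ℝ (Fin k) → F, IsPlot v ∧
          ∀ᶠ y in 𝓝 x, p y = φ (⟨π (p y), hp y⟩, v y)) : IsFibreBundle F π where
  smooth_proj := hπ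
  locally_trivial b := by
    obtain ⟨U, hU, hb, φ, hφ, hπφ, hinj, hlift⟩ := h b
    have hmem : ∀ q, π (φ q) ∈ U := fun q => by rw [hπφ]; exact q.1.2
    let Φ : U × F → π ⁻¹' U := fun q => ⟨φ q, hmem q⟩
    have hΦ : Function.Bijective Φ := by
      constructor
      · rintro ⟨u, v⟩ ⟨u', v'⟩ hq
        have h1 : φ (u, v) = φ (u', v') := congrArg Subtype.val hq
        have h2 : u = u' := Subtype.ext (by rw [← hπφ (u, v), h1, hπφ])
        subst h2
        rw [hinj u v v' h1]
      · rintro ⟨e, he⟩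
        -- A single point is a plot on `ℝ⁰`, so the lifting property also gives surjectivity.
        obtain ⟨v, -, hv⟩ := hlift 0 (fun _ => e) isPlot_const (fun _ => he) 0
        exact ⟨(⟨π e, he⟩, v 0), Subtype.ext hv.self_of_nhds.symm⟩
    refine ⟨U, hU, hb, Equiv.ofBijective Φ hΦ, ⟨hφ.subtype_mk hmem, ?_⟩, hπφ⟩
    refine dSmooth_symm_of_lift fun k p hp x => ?_
    have hp' := isPlot_subtype_iff.mp hp
    obtain ⟨v, hv, hpv⟩ := hlift k _ hp' (fun y => (p y).2) x
    refine ⟨fun y => (⟨π (p y), (p y).2⟩, v y), ⟨isPlot_subtype_iff.mpr (hπ _ _ hp'), hv⟩, ?_⟩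
    filter_upwards [hpv] with y hy
    exact Subtype.ext hy

/-- Local sections of a principal bundle, and division by them. -/
theorem IsPrincipalBundle.exists_section {G : Type*} [Group G] [DiffeologicalSpace G]
    [MulAction Gᵐᵒᵖ E] {π : E → B} (hπ : IsPrincipalBundle G π) (b : B) :
    ∃ U : Set B, IsOpen[dTopology] U ∧ b ∈ U ∧ ∃ (s : U → E) (κ : π ⁻¹' U → G),
      DSmooth s ∧ DSmooth κ ∧ (∀ u, π (s u) = u) ∧
      (∀ p : π ⁻¹' U, (p : E) = MulOpposite.op (κ p) • s ⟨π p, p.2⟩) ∧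
      ∀ (u : U) (g : G), MulOpposite.op g • s u = s u → g = 1 := by
  obtain ⟨U, hU, hb, φ, hφ, hπφ, hmul⟩ := hπ.locally_trivial b
  have hφs : ∀ (u : U) (g : G), (φ (u, g) : E) = MulOpposite.op g • (φ (u, 1) : E) := fun u g => by
    rw [← hmul, one_mul]
  refine ⟨U, hU, hb, fun u => φ (u, 1), fun p => (φ.symm p).2, ?_, dSmooth_snd.comp hφ.2,
    fun u => hπφ (u, 1), fun p => ?_, fun u g hg => ?_⟩
  · exact dSmooth_val.comp (hφ.1.comp (dSmooth_id.prodMk dSmooth_const))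
  · have h1 : (φ.symm p).1 = ⟨π p, p.2⟩ := Subtype.ext (by
      rw [← hπφ (φ.symm p), φ.apply_symm_apply])
    rw [← h1, ← hφs, Prod.mk.eta, φ.apply_symm_apply]
  · rw [← hφs] at hg
    exact (Prod.ext_iff.mp (φ.injective (Subtype.ext hg))).2

theorem IsPrincipalBundle.eq_one_of_smul_eq {G : Type*} [Group G] [DiffeologicalSpace G]
    [MulAction Gᵐᵒᵖ E] {π : E → B} (hπ : IsPrincipalBundle G π) {g : G} {p : E}
    (hg : MulOpposite.op g • p = p) : g = 1 := by
  obtain ⟨U, -, hb, s, κ, -, -, -, hκ, hfree⟩ := hπ.exists_section (π p)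
  have hp := hκ ⟨p, hb⟩
  set k := κ ⟨p, hb⟩
  -- Freeness is known only at points of the section. If `p = s k` and `p g = p`, then `k g k⁻¹`
  -- fixes `s`.
  have h1 := hfree ⟨π p, hb⟩ (k * g * k⁻¹) (by
    have h2 : p = MulOpposite.op k • s ⟨π p, hb⟩ := hp
    have h3 : MulOpposite.op (k * g * k⁻¹) • s ⟨π p, hb⟩ =
        MulOpposite.op k⁻¹ • MulOpposite.op g • MulOpposite.op k • s ⟨π p, hb⟩ := by
      simp only [smul_smul, ← MulOpposite.op_mul, mul_assoc]
    rw [h3, ← h2, hg]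
    conv_lhs => rw [h2]
    rw [smul_smul, ← MulOpposite.op_mul, mul_inv_cancel, MulOpposite.op_one, one_smul])
  simpa using h1

theorem IsPrincipalBundle.exists_smul_eq {G : Type*} [Group G] [DiffeologicalSpace G]
    [MulAction Gᵐᵒᵖ E] {π : E → B} (hπ : IsPrincipalBundle G π) {p p' : E} (h : π p = π p') :
    ∃ g : G, p' = MulOpposite.op g • p := by
  obtain ⟨U, -, hb, s, κ, -, -, -, hκ, -⟩ := hπ.exists_section (π p)
  have hp := hκ ⟨p, hb⟩
  have hp' := hκ ⟨p', show π p' ∈ U from h ▸ hb⟩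
  have hs : s ⟨π p', show π p' ∈ U from h ▸ hb⟩ = s ⟨π p, hb⟩ :=
    congrArg s (Subtype.ext h.symm)
  refine ⟨(κ ⟨p, hb⟩)⁻¹ * κ ⟨p', show π p' ∈ U from h ▸ hb⟩, ?_⟩
  have h1 : s ⟨π p, hb⟩ = MulOpposite.op (κ ⟨p, hb⟩)⁻¹ • p := by
    rw [MulOpposite.op_inv, eq_inv_smul_iff]
    exact hp.symm
  rw [MulOpposite.op_mul, mul_smul, ← h1, ← hs]
  exact hp'

theorem IsPrincipalBundle.surjective {G : Type*} [Group G] [DiffeologicalSpace G]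
    [MulAction Gᵐᵒᵖ E] {π : E → B} (hπ : IsPrincipalBundle G π) : Function.Surjective π := fun b => by
  obtain ⟨U, -, hb, s, κ, -, -, hs, -⟩ := hπ.exists_section b
  exact ⟨s ⟨b, hb⟩, hs _⟩

/-- Restricting a fibre bundle along a section of a submersion gives a subbundle of the composite
bundle. -/
theorem IsFibreBundle.isSubbundle_pullback {X F : Type*} [DiffeologicalSpace X]
    [DiffeologicalSpace F] {π : E → B} (hπ : IsFibreBundle F π) {h : X → B} (hh : DSmooth h)
    {pr : B → X} (hpr : DSmooth pr) (hsec : ∀ x, pr (h x) = x) :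
    IsSubbundle F (Pullback.base : Pullback h π → X) (pr ∘ π) Pullback.total := by
  have hbase : DSmooth (Pullback.base : Pullback h π → X) := dSmooth_fst.comp dSmooth_val
  have htotal : DSmooth (Pullback.total : Pullback h π → E) := dSmooth_snd.comp dSmooth_val
  have hover : ∀ q : Pullback h π, π q.total = h q.base := fun q => q.2
  -- The base coordinate is recovered from the total one, since `pr (π q.total) = pr (h q.base) =
  -- q.base`.
  have hext : ∀ q q' : Pullback h π, q.total = q'.total → q = q' := fun q q' hq => by
    refine Subtype.ext (Prod.ext ?_ hq)
    have h1 := congrArg (pr ∘ π) hq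
    simp only [Function.comp_apply, hover, hsec] at h1
    exact h1
  refine ⟨⟨hbase, fun x => ?_⟩, htotal, fun q q' => hext q q', fun q => ?_, fun q => ?_⟩
  · obtain ⟨U, hU, hx, φ, hφ, hπφ⟩ := hπ.locally_trivial (h x)
    let f : (h ⁻¹' U) × F → U × F := fun q => (⟨h q.1, q.1.2⟩, q.2)
    have hf : DSmooth f :=
      ((hh.comp (dSmooth_val.comp dSmooth_fst)).subtype_mk _).prodMk dSmooth_snd
    let ψ : ((h ⁻¹' U) × F) ≃ ((Pullback.base : Pullback h π → X) ⁻¹' (h ⁻¹' U)) :=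
      { toFun := fun q => ⟨⟨(q.1, φ (f q)), hπφ (f q)⟩, q.1.2⟩
        invFun := fun q => (⟨q.1.base, q.2⟩,
          (φ.symm ⟨q.1.total, show π q.1.total ∈ U from (hover q.1).symm ▸ q.2⟩).2)
        left_inv := fun q => Prod.ext rfl (by
          change (φ.symm (φ (f q))).2 = q.2
          rw [φ.symm_apply_apply])
        right_inv := fun q => by
          refine Subtype.ext (hext _ _ ?_)
          set e : π ⁻¹' U := ⟨q.1.total, show π q.1.total ∈ U from (hover q.1).symm ▸ q.2⟩ with he
          change (φ (⟨h q.1.base, q.2⟩, (φ.symm e).2) : E) = e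
          have h1 : (φ.symm e).1 = ⟨h q.1.base, q.2⟩ := Subtype.ext (by
            rw [← hπφ (φ.symm e), φ.apply_symm_apply]
            exact hover q.1)
          rw [← h1, Prod.mk.eta, φ.apply_symm_apply] }
    refine ⟨h ⁻¹' U, hh.isOpen_preimage hU, hx, ψ, ⟨?_, ?_⟩, fun q => rfl⟩
    · exact DSmooth.subtype_mk (DSmooth.subtype_mk ((dSmooth_val.comp dSmooth_fst).prodMk
        (dSmooth_val.comp (hφ.1.comp hf))) _) _
    · refine ((hbase.comp dSmooth_val).subtype_mk _).prodMk ?_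
      exact dSmooth_snd.comp (hφ.2.comp ((htotal.comp dSmooth_val).subtype_mk _))
  · change pr (π q.total) = q.base
    rw [hover, hsec]
  · obtain ⟨U, hU, hx, φ, hφ, hπφ⟩ := hπ.locally_trivial (h q.base)
    have hpπ : DSmooth fun e => h (pr (π e)) := hh.comp (hpr.comp hπ.smooth_proj)
    -- Both `π e` and `h (pr (π e))` must lie in the trivializing set, so that the fibre coordinate
    -- of `e` can be carried to the fibre over `h (pr (π e))`. On the image of `h^*E` the two base
    -- points agree and nothing moves.
    refine ⟨π ⁻¹' U ∩ (fun e => h (pr (π e))) ⁻¹' U, isOpen_dTopology_inter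
      (hπ.smooth_proj.isOpen_preimage hU) (hpπ.isOpen_preimage hU), ⟨?_, ?_⟩, ?_⟩
    · change π q.total ∈ U
      rwa [hover]
    · change h (pr (π q.total)) ∈ U
      rwa [hover, hsec]
    · refine ⟨fun e => ⟨(pr (π e), φ (⟨h (pr (π e)), e.2.2⟩, (φ.symm ⟨e.1, e.2.1⟩).2)),
        hπφ _⟩, ?_, fun q' hq' => hext _ _ ?_⟩
      · refine DSmooth.subtype_mk (DSmooth.prodMk ?_ ?_) _
        · exact hpr.comp (hπ.smooth_proj.comp dSmooth_val)
        · refine dSmooth_val.comp (hφ.1.comp (DSmooth.prodMk ?_ ?_))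
          · exact (hpπ.comp dSmooth_val).subtype_mk _
          · exact dSmooth_snd.comp (hφ.2.comp (dSmooth_val.subtype_mk _))
      · set e : π ⁻¹' U := ⟨q'.total, hq'.1⟩
        change (φ (⟨h (pr (π q'.total)), hq'.2⟩, (φ.symm e).2) : E) = e
        have h1 : (φ.symm e).1 = ⟨h (pr (π q'.total)), hq'.2⟩ := Subtype.ext (by
          rw [← hπφ (φ.symm e), φ.apply_symm_apply]
          change π q'.total = h (pr (π q'.total))
          rw [hover, hsec])
        rw [← h1, Prod.mk.eta, φ.apply_symm_apply]

end Bundles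

/-! ### Bundles associated to a principal Pin bundle -/

section AssociatedBundles

variable {m n : ℕ} {P B V : Type*} [MulAction (Pin m n)ᵐᵒᵖ P] [MulAction (GCC n) V]

/-- The outer quotient absorbs `g` into the fibre. This normal form turns the nested construction
into the bundle associated to `P` by the Pin action on `V`. -/
theorem cmk_eq_cmk_one (p : P) (g : GCC n) (a : V) : cmk m n p g a = cmk m n p 1 (g • a) := by
  have h1 : (assocSetoid (GCC n) (Ext m n P) V) (Assoc.mk (Pin m n) p 1, g • a)
      (Assoc.mk (Pin m n) p g, a) :=
    ⟨g, Prod.ext (congrArg (Assoc.mk (Pin m n) p) (one_mul g).symm) (inv_smul_smul g a).symm⟩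
  exact (Quotient.sound h1).symm

theorem cmk_smul (k : Pin m n) (p : P) (a : V) :
    cmk m n (MulOpposite.op k • p) 1 a = cmk m n p 1 (pinToGCC m n k • a) := by
  rw [← cmk_eq_cmk_one]
  have h1 : (assocSetoid (Pin m n) P (GCC n)) (p, pinToGCC m n k) (MulOpposite.op k • p, 1) := by
    refine ⟨k, Prod.ext rfl ?_⟩
    change (1 : GCC n) = pinToGCC m n k⁻¹ * pinToGCC m n k
    rw [map_inv, inv_mul_cancel]
  exact congrArg (fun e => Assoc.mk (GCC n) e a) (Quotient.sound h1).symm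

/-- The outer quotient supplies some `G` in `GCC n`. Having both middle components equal to `1`
forces `G` to be the image of the Pin element `k` of the inner quotient. -/
theorem exists_of_cmk_one_eq {p p' : P} {a a' : V} (h : cmk m n p 1 a = cmk m n p' 1 a') :
    ∃ k : Pin m n, p' = MulOpposite.op k • p ∧ a = pinToGCC m n k • a' := by
  obtain ⟨G, hG⟩ := Quotient.exact h
  obtain ⟨h1, h2⟩ := Prod.ext_iff.mp hG
  obtain ⟨k, hk⟩ := Quotient.exact (show Assoc.mk (Pin m n) p (1 * G) = Assoc.mk (Pin m n) p' 1
    from h1.symm)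
  obtain ⟨h3, h4⟩ := Prod.ext_iff.mp hk
  have h5 : (1 : GCC n) = pinToGCC m n k⁻¹ * (1 * G) := h4
  have h6 : G = pinToGCC m n k := by
    rw [map_inv, one_mul] at h5
    exact (inv_mul_eq_one.mp h5.symm).symm
  refine ⟨k, h3, ?_⟩
  rw [show a' = G⁻¹ • a from h2, ← h6, smul_inv_smul]

theorem cmk_surjective (c : Assoc (GCC n) (Ext m n P) V) : ∃ p a, c = cmk m n p 1 a := by
  induction c using Quotient.inductionOn with
  | h q =>
    obtain ⟨e, a⟩ := q
    induction e using Quotient.inductionOn with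
    | h q => exact ⟨q.1, q.2 • a, cmk_eq_cmk_one q.1 q.2 a⟩

variable [DiffeologicalSpace P] [DiffeologicalSpace B]

theorem cmk_section_injective {π : P → B} (hπ : IsPrincipalBundle (Pin m n) π) {p : P} {a a' : V}
    (h : cmk m n p 1 a = cmk m n p 1 a') : a = a' := by
  obtain ⟨k, hk, ha⟩ := exists_of_cmk_one_eq h
  rw [hπ.eq_one_of_smul_eq hk.symm, map_one, one_smul] at ha
  exact ha

variable [DiffeologicalSpace V]

theorem dSmooth_cmk_one : DSmooth fun q : P × V => cmk m n q.1 (1 : GCC n) q.2 := by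
  have h1 : DSmooth fun q : P × V => Assoc.mk (Pin m n) q.1 (1 : GCC n) :=
    (dSmooth_quotientMk (assocSetoid (Pin m n) P (GCC n))).comp
      (dSmooth_fst.prodMk dSmooth_const)
  exact (dSmooth_quotientMk (assocSetoid (GCC n) (Ext m n P) V)).comp (h1.prodMk dSmooth_snd)

/-- Lift through the outer quotient, then through the inner one, and move the resulting plot of
units into the fibre by the smooth action. Smoothness questions on associated bundles thus reduce to
plots of `P` and `V`. -/
theorem exists_lift_cmk (hV : DSmooth fun q : GCC n × V => q.1 • q.2) {k : ℕ}
    {p : EuclideanSpace ℝ (Fin k) → Assoc (GCC n) (Ext m n P) V} (hp : IsPlot p)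
    (x : EuclideanSpace ℝ (Fin k)) :
    ∃ (q : EuclideanSpace ℝ (Fin k) → P) (a : EuclideanSpace ℝ (Fin k) → V), IsPlot q ∧ IsPlot a ∧
      ∀ᶠ y in 𝓝 x, p y = cmk m n (q y) 1 (a y) := by
  obtain ⟨r, hr, hpr⟩ := exists_lift_quotient hp x
  obtain ⟨r', hr', hrr'⟩ := exists_lift_quotient (show IsPlot fun y => (r y).1 from hr.1) x
  refine ⟨fun y => (r' y).1, fun y => (r' y).2 • (r y).2, hr'.1,
    hV k (fun y => ((r' y).2, (r y).2)) ⟨hr'.2, hr.2⟩, ?_⟩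
  filter_upwards [hpr, hrr'] with y h1 h2
  rw [← cmk_eq_cmk_one, h1]
  exact congrArg (Quotient.mk _) (Prod.ext h2 rfl)

theorem dSmooth_cproj (hV : DSmooth fun q : GCC n × V => q.1 • q.2) {π : P → B} (hπ : DSmooth π)
    (hinv : ∀ (g : Pin m n) (p : P), π (MulOpposite.op g • p) = π p) :
    DSmooth (cproj m n π hinv : Assoc (GCC n) (Ext m n P) V → B) := by
  intro k p hp
  refine isPlot_of_eventuallyEq fun x => ?_
  obtain ⟨q, a, hq, -, h⟩ := exists_lift_cmk hV hp x
  refine ⟨fun y => π (q y), hπ _ _ hq, ?_⟩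
  filter_upwards [h] with y hy
  simp only [Function.comp_apply, hy]
  rfl

omit [DiffeologicalSpace B] in
/-- Over the domain of a local section, plots of an associated bundle are given by plots of the
fibre. -/
theorem exists_lift_section (hV : DSmooth fun q : GCC n × V => q.1 • q.2) {π : P → B}
    (hinv : ∀ (g : Pin m n) (p : P), π (MulOpposite.op g • p) = π p)
    {U : Set B} {s : U → P} {κ : π ⁻¹' U → Pin m n} (hκ : DSmooth κ)
    (hsκ : ∀ p : π ⁻¹' U, (p : P) = MulOpposite.op (κ p) • s ⟨π p, p.2⟩) {k : ℕ}
    {p : EuclideanSpace ℝ (Fin k) → Assoc (GCC n) (Ext m n P) V} (hp : IsPlot p)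
    (hpU : ∀ y, cproj m n π hinv (p y) ∈ U) (x : EuclideanSpace ℝ (Fin k)) :
    ∃ v : EuclideanSpace ℝ (Fin k) → V, IsPlot v ∧
      ∀ᶠ y in 𝓝 x, p y = cmk m n (s ⟨cproj m n π hinv (p y), hpU y⟩) 1 (v y) := by
  obtain ⟨q, a, hq, ha, h⟩ := exists_lift_cmk hV hp x
  have hqU : ∀ᶠ y in 𝓝 x, π (q y) ∈ U := by
    filter_upwards [h] with y hy
    have := hpU y
    rwa [hy] at this
  -- The lift `q` is related to `p` only near `x` and may leave the domain of `κ` elsewhere.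
  obtain ⟨q', hq', hqU', hqq'⟩ := exists_isPlot_forall (r := fun p => π p ∈ U) hq hqU
  have hκq : IsPlot fun y => pinToGCC m n (κ ⟨q' y, hqU' y⟩) :=
    (dSmooth_pinToGCC.comp hκ) k (fun y => ⟨q' y, hqU' y⟩) (isPlot_subtype_iff.mpr hq')
  refine ⟨fun y => pinToGCC m n (κ ⟨q' y, hqU' y⟩) • a y, hV k (fun y => (_, _)) ⟨hκq, ha⟩, ?_⟩
  filter_upwards [h, hqq'] with y h1 h2
  have h3 : cproj m n π hinv (p y) = π (q' y) := by rw [h1, h2]; rfl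
  have h4 : s ⟨cproj m n π hinv (p y), hpU y⟩ = s ⟨π (q' y), hqU' y⟩ :=
    congrArg s (Subtype.ext h3)
  rw [h4, ← cmk_smul, ← hsκ ⟨q' y, hqU' y⟩, h1, ← h2]

/-- The bundles associated to a principal Pin bundle are fibre bundles. -/
theorem isFibreBundle_cproj (hV : DSmooth fun q : GCC n × V => q.1 • q.2) {π : P → B}
    (hπ : IsPrincipalBundle (Pin m n) π) :
    IsFibreBundle V (cproj m n π hπ.proj_smul : Assoc (GCC n) (Ext m n P) V → B) := by
  refine isFibreBundle_of_local (dSmooth_cproj hV hπ.smooth_proj _) fun b => ?_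
  obtain ⟨U, hU, hb, s, κ, hs, hκ, hπs, hsκ, -⟩ := hπ.exists_section b
  refine ⟨U, hU, hb, fun q => cmk m n (s q.1) 1 q.2, ?_, fun q => hπs q.1, fun u v v' h =>
    cmk_section_injective hπ h, fun k p hp hpU x => exists_lift_section hV _ hκ hsκ hp hpU x⟩
  exact dSmooth_cmk_one.comp ((hs.comp dSmooth_fst).prodMk dSmooth_snd)

/-- Left multiplication by Pin preserves the real subalgebra, so real fibre coordinates are real
with respect to every local section. -/
theorem pinToGCC_smul_realIncl (k : Pin m n) (a : RealClifford m n) :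
    pinToGCC m n k • realIncl m n a =
      realIncl m n (((k : (RealClifford m n)ˣ) : RealClifford m n) * a) :=
  (map_mul (realIncl m n) _ a).symm

theorem exists_smooth_leftInverse_realIncl (m n : ℕ) :
    ∃ r : ComplexClifford n → RealClifford m n, DSmooth r ∧ ∀ a, r (realIncl m n a) = a := by
  obtain ⟨f, hf⟩ := LinearMap.exists_leftInverse_of_injective (realIncl m n).toLinearMap
    (LinearMap.ker_eq_bot.mpr (realIncl_injective m n))
  exact ⟨f, dSmooth_linearMap f, fun a => LinearMap.congr_fun hf a⟩

/-- The bundle in real Clifford algebras is a fibre bundle. -/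
theorem isFibreBundle_realCliffordBundle {π : P → B} (hπ : IsPrincipalBundle (Pin m n) π) :
    IsFibreBundle (RealClifford m n)
      (fun c : RealCliffordBundle m n P => cproj m n π hπ.proj_smul c.1) := by
  refine isFibreBundle_of_local ((dSmooth_cproj dSmooth_smul_complexClifford
    hπ.smooth_proj _).comp dSmooth_val) fun b => ?_
  obtain ⟨U, hU, hb, s, κ, hs, hκ, hπs, hsκ, -⟩ := hπ.exists_section b
  obtain ⟨r, hr, hrl⟩ := exists_smooth_leftInverse_realIncl m n
  refine ⟨U, hU, hb, fun q => ⟨cmk m n (s q.1) 1 (realIncl m n q.2), s q.1, q.2, rfl⟩, ?_,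
    fun q => hπs q.1, fun u v v' h => ?_, fun k p hp hpU x => ?_⟩
  · exact DSmooth.subtype_mk (dSmooth_cmk_one.comp
      ((hs.comp dSmooth_fst).prodMk (dSmooth_realIncl.comp dSmooth_snd))) _
  · exact realIncl_injective m n (cmk_section_injective hπ (congrArg Subtype.val h))
  · obtain ⟨v, hv, h⟩ := exists_lift_section dSmooth_smul_complexClifford hπ.proj_smul hκ hsκ
      (isPlot_subtype_iff.mp hp) hpU x
    -- The complex coordinate `v` lies in the image of `realIncl` near `x`, because `p` takes values
    -- in the real bundle; the linear left inverse `r` extracts the real coordinate smoothly.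
    refine ⟨fun y => r (v y), hr k v hv, ?_⟩
    filter_upwards [h] with y hy
    refine Subtype.ext (hy.trans ?_)
    obtain ⟨p', a', hp'⟩ := (p y).2
    obtain ⟨j, -, hj⟩ := exists_of_cmk_one_eq (hy.symm.trans hp')
    rw [pinToGCC_smul_realIncl] at hj
    rw [hj, hrl]

end AssociatedBundles

/-! ### The frame bundle over a manifold -/

section Manifold

variable {n : ℕ} {X : Type*} [TopologicalSpace X] [ChartedSpace (EuclideanSpace ℝ (Fin n)) X]

/-- A chart near a point, with an everywhere defined inverse, contained in a given neighbourhood. -/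
theorem exists_chart_plot [IsManifold (𝓡 n) ∞ X] {W : Set X} (hW : IsOpen W) {x : X} (hx : x ∈ W) :
    ∃ (e : EuclideanSpace ℝ (Fin n) → X) (c : X → EuclideanSpace ℝ (Fin n)) (V : Set X),
      @IsPlot _ (manifoldDiffeology (𝓡 n) X) _ e ∧ (∀ t, e t ∈ W) ∧ IsOpen V ∧ x ∈ V ∧ V ⊆ W ∧
      (∀ y ∈ V, e (c y) = y) ∧ ContinuousOn c V ∧
      ∀ (k : ℕ) (p : EuclideanSpace ℝ (Fin k) → X), @IsPlot _ (manifoldDiffeology (𝓡 n) X) _ p →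
        (∀ y, p y ∈ V) → ContDiff ℝ ∞ fun y => c (p y) := by
  let φ := chartAt (EuclideanSpace ℝ (Fin n)) x
  have hxs : x ∈ φ.source := mem_chart_source _ x
  let u : Set (EuclideanSpace ℝ (Fin n)) := φ.target ∩ φ.symm ⁻¹' W
  have hu : IsOpen u := φ.symm.isOpen_inter_preimage hW
  have hxu : φ x ∈ u := ⟨φ.map_source hxs, by simpa [φ.left_inv hxs] using hx⟩
  -- Composing the inverse chart with a cutoff defines it on all of `ℝⁿ`; it is a true inverse only
  -- on the smaller set where the cutoff is the identity.
  obtain ⟨f, hf, hfu, -, hfe⟩ := exists_smooth_cutoff hu hxu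
  obtain ⟨w, hw, hwo, hxw⟩ := eventually_nhds_iff.mp hfe
  refine ⟨fun t => φ.symm (f t), φ, (φ.source ∩ φ ⁻¹' w) ∩ W, ?_, fun t => (hfu t).2,
    (φ.isOpen_inter_preimage hwo).inter hW, ⟨⟨hxs, hxw⟩, hx⟩, Set.inter_subset_right, ?_, ?_, ?_⟩
  · have h1 : ContMDiffOn (𝓡 n) (𝓡 n) ∞ φ.symm φ.target := contMDiffOn_chart_symm
    exact h1.comp_contMDiff hf.contMDiff fun t => (hfu t).1
  · rintro y ⟨⟨hys, hyw⟩, -⟩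
    change φ.symm (f (φ y)) = y
    rw [hw _ hyw]
    exact φ.left_inv hys
  · exact φ.continuousOn.mono fun y hy => hy.1.1
  · intro k p hp hpV
    have h1 : ContMDiffOn (𝓡 n) (𝓡 n) ∞ φ φ.source := contMDiffOn_chart
    have h2 : ContMDiff (𝓡 k) (𝓡 n) ∞ p := hp
    exact (h1.comp_contMDiff h2 fun y => (hpV y).1.1).contDiff

/-- The D-topology of a manifold is its topology. -/
theorem isOpen_manifoldDiffeology_iff [IsManifold (𝓡 n) ∞ X] {U : Set X} :
    IsOpen[@dTopology X (manifoldDiffeology (𝓡 n) X)] U ↔ IsOpen U := by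
  constructor
  · intro hU
    refine isOpen_iff_mem_nhds.mpr fun x hx => ?_
    obtain ⟨e, c, V, he, -, hV, hxV, -, hec, hc, -⟩ :=
      exists_chart_plot (n := n) isOpen_univ (Set.mem_univ x)
    have h1 : IsOpen (e ⁻¹' U) :=
      (@isOpen_iff_preimages_plots X (manifoldDiffeology (𝓡 n) X) U).mp hU n e he
    refine Filter.mem_of_superset ((hc.isOpen_inter_preimage hV h1).mem_nhds ⟨hxV, ?_⟩) ?_
    · change e (c x) ∈ U
      rwa [hec x hxV]
    · rintro y ⟨hy, hy'⟩
      have h2 : e (c y) ∈ U := hy'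
      rwa [hec y hy] at h2
  · intro hU
    refine (@isOpen_iff_preimages_plots X (manifoldDiffeology (𝓡 n) X) U).mpr fun k p hp => ?_
    have h2 : ContMDiff (𝓡 k) (𝓡 n) ∞ p := hp
    exact h2.continuous.isOpen_preimage U hU

variable [IsManifold (𝓡 n) ∞ X]

theorem dSmooth_frameBundle_base :
    @DSmooth (FrameBundle n X) X _ (manifoldDiffeology (𝓡 n) X) fun f => f.1 := by
  intro k p hp
  -- Any fixed vector would do: the tangent vector it gives already carries the base point.
  have h1 : ContMDiff (𝓡 k) (𝓡 n).tangent ∞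
      fun y => (⟨(p y).1, (p y).2 0⟩ : TangentBundle (𝓡 n) X) := hp 0
  have h2 : ContMDiff (𝓡 n).tangent (𝓡 n) ∞
      (Bundle.TotalSpace.proj : TangentBundle (𝓡 n) X → X) := Bundle.contMDiff_proj _
  exact h2.comp h1

variable {m : ℕ}

theorem dSmooth_metricBundle_proj :
    @DSmooth (MetricBundle m n X) X _ (manifoldDiffeology (𝓡 n) X) MetricBundle.proj := by
  let _ : DiffeologicalSpace X := manifoldDiffeology (𝓡 n) X
  intro k p hp
  refine isPlot_of_eventuallyEq fun x => ?_
  obtain ⟨q, hq, h⟩ := exists_lift_quotient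
    (s := MulAction.orbitRel (Orth m n)ᵐᵒᵖ (FrameBundle n X)) hp x
  refine ⟨fun y => (q y).1, dSmooth_frameBundle_base k q hq, ?_⟩
  filter_upwards [h] with y hy
  exact congrArg MetricBundle.proj hy

end Manifold

/-! ### The pull-back of a Pin-lift -/

section PullbackLift

variable {m n : ℕ} {X : Type*} [TopologicalSpace X] [ChartedSpace (EuclideanSpace ℝ (Fin n)) X]
  [IsManifold (𝓡 n) ∞ X] {P : Type*} [DiffeologicalSpace P] [MulAction (Pin m n)ᵐᵒᵖ P]
  {z : P → FrameBundle n X} {h : X → MetricBundle m n X}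

theorem toMetric_eq_of_reducedFrames (hh : IsGlobalSection h) (f : ReducedFrames h) :
    toMetric m f.1 = h f.proj := by
  obtain ⟨x, hx⟩ := f.2
  have h1 : x = f.proj := by
    rw [← hh.2 x, hx]
    rfl
  rw [← hx, h1]

omit [DiffeologicalSpace P] [MulAction (Pin m n)ᵐᵒᵖ P] in
theorem pullbackLift_proj (hh : IsGlobalSection h) (q : PullbackPin h z) :
    (pullbackLift h z q).proj = q.base := by
  have h1 : toMetric m (z q.total) = h q.base := q.2
  rw [← hh.2 q.base, ← h1]
  rfl

/-- Trivializations of `P → Σ` pull back along `h`. A frame at `x` belongs to `L^hX` exactly when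
its class is `h x`, so its preimages under `z` give points of `h^*P`; surjectivity and local lifting
are inherited from `z`. -/
theorem isPinLift_pullbackLift (hz : IsPinLift m n (toMetric m) z) (hh : IsGlobalSection h) :
    letI : DiffeologicalSpace X := manifoldDiffeology (𝓡 n) X
    letI : MulAction (Pin m n)ᵐᵒᵖ (PullbackPin h z) :=
      pullbackPinAction h z hz.principal.proj_smul
    IsPinLift m n ReducedFrames.proj (pullbackLift h z) := by
  let _ : DiffeologicalSpace X := manifoldDiffeology (𝓡 n) X
  let _ : MulAction (Pin m n)ᵐᵒᵖ (PullbackPin h z) :=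
    pullbackPinAction h z hz.principal.proj_smul
  have hhs : DSmooth h := hh.1
  have hbase : DSmooth (Pullback.base : PullbackPin h z → X) := dSmooth_fst.comp dSmooth_val
  have htotal : DSmooth (Pullback.total : PullbackPin h z → P) := dSmooth_snd.comp dSmooth_val
  have hover : ∀ q : PullbackPin h z, toMetric m (z q.total) = h q.base := fun q => q.2
  have hproj : (ReducedFrames.proj ∘ pullbackLift h z) = Pullback.base :=
    funext (pullbackLift_proj hh)
  refine ⟨?_, ?_, ?_, ?_, ?_⟩
  · rw [hproj]
    refine ⟨hbase, ?_, fun g p => rfl, fun x => ?_⟩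
    · exact DSmooth.subtype_mk ((hbase.comp dSmooth_fst).prodMk (hz.principal.smooth_action.comp
        ((htotal.comp dSmooth_fst).prodMk dSmooth_snd)))
        fun q => (hz.principal.proj_smul q.2 q.1.total).trans q.1.2
    · obtain ⟨U, hU, hx, φ, hφ, hπφ, hmul⟩ := hz.principal.locally_trivial (h x)
      let f : (h ⁻¹' U) × Pin m n → U × Pin m n := fun q => (⟨h q.1, q.1.2⟩, q.2)
      have hf : DSmooth f :=
        ((hhs.comp (dSmooth_val.comp dSmooth_fst)).subtype_mk _).prodMk dSmooth_snd
      have hmem : ∀ q : (Pullback.base : PullbackPin h z → X) ⁻¹' (h ⁻¹' U),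
          (toMetric m ∘ z) q.1.total ∈ U := fun q => by
        have h2 : h q.1.base ∈ U := q.2
        rw [← hover] at h2
        exact h2
      let ψ : ((h ⁻¹' U) × Pin m n) ≃ ((Pullback.base : PullbackPin h z → X) ⁻¹' (h ⁻¹' U)) :=
        { toFun := fun q => ⟨⟨(q.1, φ (f q)), hπφ (f q)⟩, q.1.2⟩
          invFun := fun q => (⟨q.1.base, q.2⟩, (φ.symm ⟨q.1.total, hmem q⟩).2)
          left_inv := fun q => Prod.ext rfl (by
            change (φ.symm (φ (f q))).2 = q.2
            rw [φ.symm_apply_apply])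
          right_inv := fun q => by
            refine Subtype.ext (Subtype.ext (Prod.ext rfl ?_))
            set e : (toMetric m ∘ z) ⁻¹' U := ⟨q.1.total, hmem q⟩ with he
            change (φ (⟨h q.1.base, q.2⟩, (φ.symm e).2) : P) = e
            have h1 : (φ.symm e).1 = ⟨h q.1.base, q.2⟩ := Subtype.ext (by
              rw [← hπφ (φ.symm e), φ.apply_symm_apply]
              exact hover q.1)
            rw [← h1, Prod.mk.eta, φ.apply_symm_apply] }
      refine ⟨h ⁻¹' U, hhs.isOpen_preimage hU, hx, ψ, ⟨?_, ?_⟩, fun q => rfl, fun b g g' => ?_⟩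
      · exact DSmooth.subtype_mk (DSmooth.subtype_mk ((dSmooth_val.comp dSmooth_fst).prodMk
          (dSmooth_val.comp (hφ.1.comp hf))) _) _
      · refine ((hbase.comp dSmooth_val).subtype_mk fun q => q.2).prodMk ?_
        exact dSmooth_snd.comp (hφ.2.comp ((htotal.comp dSmooth_val).subtype_mk hmem))
      · exact Subtype.ext (Prod.ext rfl (hmul ⟨h b, b.2⟩ g g'))
  · exact (hz.smooth.comp htotal).subtype_mk _
  · intro g q
    exact Subtype.ext (hz.equivariant g q.total)
  · intro f
    obtain ⟨p, hp⟩ := hz.surjective f.1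
    refine ⟨⟨(f.proj, p), ?_⟩, Subtype.ext hp⟩
    change toMetric m (z p) = _
    rw [hp, toMetric_eq_of_reducedFrames hh]
  · intro k p hp x
    have hp' := isPlot_subtype_iff.mp hp
    obtain ⟨q, hq, hpq⟩ := hz.submersive k _ hp' x
    have hb : IsPlot fun y => (p y).proj := dSmooth_frameBundle_base k _ hp'
    -- The pair of base point and lift satisfies the pull-back equation only near `x`; the cutoff
    -- makes it hold everywhere.
    obtain ⟨r, hr, hrm, hre⟩ := exists_isPlot_forall
      (r := fun a : X × P => toMetric m (z a.2) = h a.1)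
      (show IsPlot fun y => ((p y).proj, q y) from ⟨hb, hq⟩) (x := x) (by
        filter_upwards [hpq] with y hy
        rw [← toMetric_eq_of_reducedFrames hh]
        exact congrArg (toMetric m) hy.symm)
    refine ⟨fun y => ⟨r y, hrm y⟩, isPlot_subtype_iff.mpr hr, ?_⟩
    filter_upwards [hpq, hre] with y h1 h2
    refine Subtype.ext (h1.trans ?_)
    change z (q y) = z (r y).2
    rw [h2]

end PullbackLift

/-! ### Comparison of the bundles built from equivalent lifts -/

section Comparison

variable {m n : ℕ} {P Q V : Type*} [MulAction (Pin m n)ᵐᵒᵖ P] [MulAction (Pin m n)ᵐᵒᵖ Q]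
  [MulAction (GCC n) V]

/-- The map of associated bundles induced by an equivariant map. -/
noncomputable def cmap (f : Q → P) (hf : ∀ (g : Pin m n) (q : Q),
    f (MulOpposite.op g • q) = MulOpposite.op g • f q) :
    Assoc (GCC n) (Ext m n Q) V → Assoc (GCC n) (Ext m n P) V :=
  Quotient.map (fun e => (Quotient.map (fun q => (f q.1, q.2)) (by
    rintro a b ⟨g, rfl⟩
    exact ⟨g, Prod.ext (hf g a.1) rfl⟩) e.1, e.2)) (by
    rintro ⟨e, a⟩ b ⟨G, rfl⟩
    refine ⟨G, Prod.ext ?_ rfl⟩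
    induction e using Quotient.inductionOn with
    | h q => rfl)

theorem cmap_cmk (f : Q → P) (hf : ∀ (g : Pin m n) (q : Q),
    f (MulOpposite.op g • q) = MulOpposite.op g • f q) (q : Q) (g : GCC n) (a : V) :
    cmap f hf (cmk m n q g a) = cmk m n (f q) g a :=
  rfl

variable {X B : Type*} [DiffeologicalSpace P] [DiffeologicalSpace Q] [DiffeologicalSpace V]
  [DiffeologicalSpace X] [DiffeologicalSpace B] {h : X → B} {π : P → B}

/-- An equivariant diffeomorphism of `Q` with a pull-back of `P` induces diffeomorphisms of the
associated bundles. -/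
theorem exists_equiv_pullback (hV : DSmooth fun q : GCC n × V => q.1 • q.2)
    (hh : Function.Injective h)
    (hπ : ∀ (g : Pin m n) (p : P), π (MulOpposite.op g • p) = π p)
    (hπs : DSmooth π) {pr : B → X} (hpr : DSmooth pr) (hsec : ∀ x, pr (h x) = x)
    (F : Q ≃ Pullback h π) (hF : IsDiffeo F)
    (hFe : ∀ (g : Pin m n) (q : Q),
      (F (MulOpposite.op g • q)).total = MulOpposite.op g • (F q).total) :
    ∃ Φ : Assoc (GCC n) (Ext m n Q) V ≃ Pullback h (cproj (V := V) m n π hπ), IsDiffeo Φ ∧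
      (∀ q g a, (Φ (cmk m n q g a)).base = (F q).base) ∧
      ∀ q g a, (Φ (cmk m n q g a)).total = cmk m n (F q).total g a := by
  let f : Q → P := fun q => (F q).total
  have hover : ∀ q, π (f q) = h (F q).base := fun q => (F q).2
  have hfs : DSmooth f := dSmooth_snd.comp (dSmooth_val.comp hF.1)
  have hmem : ∀ c : Assoc (GCC n) (Ext m n Q) V, cproj m n π hπ (cmap f hFe c) =
      h (pr (cproj m n π hπ (cmap f hFe c))) := fun c => by
    obtain ⟨q, a, rfl⟩ := cmk_surjective c
    rw [cmap_cmk]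
    change π (f q) = h (pr (π (f q)))
    rw [hover, hsec]
  let Φ₀ : Assoc (GCC n) (Ext m n Q) V → Pullback h (cproj (V := V) m n π hπ) := fun c =>
    ⟨(pr (cproj m n π hπ (cmap f hFe c)), cmap f hFe c), hmem c⟩
  have hbij : Function.Bijective Φ₀ := by
    constructor
    · intro c c' hc
      obtain ⟨q, a, rfl⟩ := cmk_surjective c
      obtain ⟨q', a', rfl⟩ := cmk_surjective c'
      have h1 : cmk m n (f q) 1 a = cmk m n (f q') 1 a' := congrArg Pullback.total hc
      obtain ⟨k, hk, rfl⟩ := exists_of_cmk_one_eq h1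
      -- Equal total components have equal images under `h` of their base points, and `h` is
      -- injective.
      have h2 : F q' = F (MulOpposite.op k • q) := by
        have h3 : (F q').total = (F (MulOpposite.op k • q)).total := by rw [hFe]; exact hk
        refine Subtype.ext (Prod.ext (hh ?_) h3)
        change h (F q').base = h (F (MulOpposite.op k • q)).base
        rw [← hover, ← hover]
        exact congrArg π h3
      rw [F.injective h2, cmk_smul]
    · rintro ⟨⟨x, c⟩, hc⟩
      obtain ⟨p, a, rfl⟩ := cmk_surjective c
      have hp : π p = h x := hc
      let d : Pullback h π := ⟨(x, p), hp⟩
      refine ⟨cmk m n (F.symm d) 1 a, ?_⟩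
      have h1 : f (F.symm d) = p := congrArg Pullback.total (F.apply_symm_apply d)
      have h2 : cmap f hFe (cmk m n (F.symm d) 1 a) = cmk m n p 1 a := by
        rw [cmap_cmk, h1]
      refine Subtype.ext (Prod.ext ?_ h2)
      change pr (cproj m n π hπ (cmap f hFe _)) = x
      rw [h2]
      change pr (π p) = x
      rw [hp, hsec]
  have hcs : DSmooth (cmap f hFe : Assoc (GCC n) (Ext m n Q) V → _) := by
    intro k p hp
    refine isPlot_of_eventuallyEq fun x => ?_
    obtain ⟨q, a, hq, ha, hpq⟩ := exists_lift_cmk hV hp x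
    refine ⟨fun y => cmk m n (f (q y)) 1 (a y),
      dSmooth_cmk_one k (fun y => (f (q y), a y)) ⟨hfs _ _ hq, ha⟩, ?_⟩
    filter_upwards [hpq] with y hy
    simp only [Function.comp_apply, hy, cmap_cmk]
  refine ⟨Equiv.ofBijective Φ₀ hbij, ⟨?_, ?_⟩, fun q g a => ?_, fun q g a => rfl⟩
  · exact DSmooth.subtype_mk ((hpr.comp ((dSmooth_cproj hV hπs hπ).comp hcs)).prodMk hcs) _
  · refine dSmooth_symm_of_lift fun k p hp x => ?_
    have hp' := isPlot_subtype_iff.mp hp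
    obtain ⟨q, a, hq, ha, hpq⟩ :=
      exists_lift_cmk hV (show IsPlot fun y => (p y).total from hp'.2) x
    obtain ⟨r, hr, hrm, hre⟩ := exists_isPlot_forall
      (r := fun a : X × P => π a.2 = h a.1)
      (show IsPlot fun y => ((p y).base, q y) from ⟨hp'.1, hq⟩) (x := x) (by
        filter_upwards [hpq] with y hy
        have h1 : cproj m n π hπ (p y).total = h (p y).base := (p y).2
        rw [hy] at h1
        exact h1)
    let r' : EuclideanSpace ℝ (Fin k) → Pullback h π := fun y => ⟨r y, hrm y⟩
    have hr' : IsPlot r' := isPlot_subtype_iff.mpr hr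
    refine ⟨fun y => cmk m n (F.symm (r' y)) 1 (a y),
      dSmooth_cmk_one k (fun y => (F.symm (r' y), a y)) ⟨hF.2 _ _ hr', ha⟩, ?_⟩
    filter_upwards [hpq, hre] with y h1 h2
    have h3 : f (F.symm (r' y)) = q y :=
      (congrArg Pullback.total (F.apply_symm_apply (r' y))).trans (congrArg Prod.snd h2)
    have h4 : cmap f hFe (cmk m n (F.symm (r' y)) 1 (a y)) = (p y).total := by
      rw [cmap_cmk, h3, h1]
    refine Subtype.ext (Prod.ext ?_ h4.symm)
    change (p y).base = pr (cproj m n π hπ (cmap f hFe _))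
    rw [h4, show cproj m n π hπ (p y).total = h (p y).base from (p y).2, hsec]
  · change pr (π (f q)) = _
    rw [hover, hsec]

omit [DiffeologicalSpace B] in
/-- The diffeomorphism of Clifford bundles restricts to the bundles in real Clifford algebras. -/
theorem exists_equiv_realCliffordBundle
    (hπ : ∀ (g : Pin m n) (p : P), π (MulOpposite.op g • p) = π p)
    (F : Q ≃ Pullback h π)
    (Φ : CliffordBundle m n Q ≃ Pullback h (cproj (V := ComplexClifford n) m n π hπ))
    (hΦ : IsDiffeo Φ) (hΦF : ∀ q g a, (Φ (cmk m n q g a)).total = cmk m n (F q).total g a)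
    (hh : Function.Injective h) :
    ∃ ΦR : RealCliffordBundle m n Q ≃
        Pullback h (fun c : RealCliffordBundle m n P => cproj m n π hπ c.1), IsDiffeo ΦR ∧
      (∀ c, (ΦR c).base = (Φ c).base) ∧
      ∀ c, ((ΦR c).total : CliffordBundle m n P) = (Φ c).total := by
  have hto : ∀ c ∈ RealCliffordBundle m n Q, (Φ c).total ∈ RealCliffordBundle m n P := by
    rintro _ ⟨q, a, rfl⟩
    exact ⟨(F q).total, a, hΦF _ _ _⟩
  -- If the total component is `[[p, 1], a]` with `a` real, then `(x, p)` lies in the pull-back of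
  -- `P`, and its preimage under `F` with the same `a` is the required real class.
  have hinv : ∀ d : Pullback h (cproj (V := ComplexClifford n) m n π hπ),
      d.total ∈ RealCliffordBundle m n P → Φ.symm d ∈ RealCliffordBundle m n Q := by
    rintro ⟨⟨x, c⟩, hc⟩ ⟨p, a, rfl⟩
    have hp : π p = h x := hc
    let d : Pullback h π := ⟨(x, p), hp⟩
    refine ⟨F.symm d, a, (Equiv.symm_apply_eq Φ).mpr ?_⟩
    have h1 : cmk m n p 1 (realIncl m n a) =
        (Φ (cmk m n (F.symm d) 1 (realIncl m n a))).total := by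
      rw [hΦF, F.apply_symm_apply]; rfl
    refine Subtype.ext (Prod.ext (hh ?_) h1)
    exact hc.symm.trans ((congrArg _ h1).trans (Φ _).2)
  have hfs : DSmooth fun d : Pullback h (fun c : RealCliffordBundle m n P => cproj m n π hπ c.1) =>
      (⟨(d.base, d.total.1), d.2⟩ : Pullback h (cproj (V := ComplexClifford n) m n π hπ)) :=
    DSmooth.subtype_mk ((dSmooth_fst.comp dSmooth_val).prodMk
      (dSmooth_val.comp (dSmooth_snd.comp dSmooth_val))) _
  refine ⟨⟨fun c => ⟨((Φ c).base, ⟨(Φ c).total, hto c c.2⟩), (Φ c).2⟩,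
    fun d => ⟨Φ.symm ⟨(d.base, d.total.1), d.2⟩, hinv _ d.total.2⟩, fun c => ?_, fun d => ?_⟩,
    ⟨?_, ?_⟩, fun c => rfl, fun c => rfl⟩
  · refine Subtype.ext ?_
    exact Φ.symm_apply_apply c.1
  · have h1 := Φ.apply_symm_apply ⟨(d.base, d.total.1), d.2⟩
    exact Subtype.ext (Prod.ext (congrArg Pullback.base h1)
      (Subtype.ext (congrArg Pullback.total h1)))
  · have h1 : DSmooth fun c : RealCliffordBundle m n Q => Φ c := hΦ.1.comp dSmooth_val
    exact DSmooth.subtype_mk ((dSmooth_fst.comp (dSmooth_val.comp h1)).prodMk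
      ((dSmooth_snd.comp (dSmooth_val.comp h1)).subtype_mk _)) _
  · exact (hΦ.2.comp hfs).subtype_mk _

end Comparison

/-! ### Plots and morphisms of principal bundles -/

section Principal

variable {m n : ℕ} {E E' B : Type*} [DiffeologicalSpace E] [DiffeologicalSpace E']
  [DiffeologicalSpace B] [MulAction (Pin m n)ᵐᵒᵖ E] [MulAction (Pin m n)ᵐᵒᵖ E']
  {π : E → B} {π' : E' → B}

theorem IsPrincipalBundle.smul_left_cancel (hπ : IsPrincipalBundle (Pin m n) π) {g g' : Pin m n}
    {p : E} (h : MulOpposite.op g • p = MulOpposite.op g' • p) : g = g' := by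
  have h1 : MulOpposite.op (g * g'⁻¹) • p = p := by
    rw [MulOpposite.op_mul, mul_smul, h, MulOpposite.op_inv, inv_smul_smul]
  exact mul_inv_eq_one.mp (hπ.eq_one_of_smul_eq h1)

theorem IsPrincipalBundle.exists_lift (hπ : IsPrincipalBundle (Pin m n) π) {k : ℕ}
    {p : EuclideanSpace ℝ (Fin k) → B} (hp : IsPlot p) (x : EuclideanSpace ℝ (Fin k)) :
    ∃ q : EuclideanSpace ℝ (Fin k) → E, IsPlot q ∧ ∀ᶠ y in 𝓝 x, π (q y) = p y := by
  obtain ⟨U, hU, hx, s, κ, hs, -, hπs, -⟩ := hπ.exists_section (p x)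
  obtain ⟨p', hp', hpU, hpp⟩ := exists_isPlot_forall (r := fun b => b ∈ U) hp
    ((isOpen_iff_preimages_plots.mp hU k p hp).mem_nhds hx)
  refine ⟨fun y => s ⟨p' y, hpU y⟩, hs k _ (isPlot_subtype_iff.mpr hp'), ?_⟩
  filter_upwards [hpp] with y hy
  rw [hπs]
  exact hy

/-- Division of plots in a principal bundle is smooth. -/
theorem IsPrincipalBundle.isPlot_div (hπ : IsPrincipalBundle (Pin m n) π) {k : ℕ}
    {p q : EuclideanSpace ℝ (Fin k) → E} (hp : IsPlot p) (hq : IsPlot q)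
    {g : EuclideanSpace ℝ (Fin k) → Pin m n} (hg : ∀ y, q y = MulOpposite.op (g y) • p y) :
    IsPlot g := by
  refine isPlot_of_eventuallyEq fun x => ?_
  obtain ⟨U, hU, hx, s, κ, -, hκ, -, hsκ, -⟩ := hπ.exists_section (π (p x))
  have hπq : ∀ y, π (q y) = π (p y) := fun y => by rw [hg, hπ.proj_smul]
  obtain ⟨r, hr, hrU, hre⟩ := exists_isPlot_forall (r := fun e : E × E => π e.1 ∈ U ∧ π e.2 ∈ U)
    (show IsPlot fun y => (p y, q y) from ⟨hp, hq⟩) (x := x) (by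
      filter_upwards [(isOpen_iff_preimages_plots.mp hU k _ (hπ.smooth_proj k p hp)).mem_nhds hx]
        with y hy
      exact ⟨hy, by rw [hπq]; exact hy⟩)
  have h1 : IsPlot fun y => κ ⟨(r y).1, (hrU y).1⟩ :=
    hκ k (fun y => ⟨(r y).1, (hrU y).1⟩) (isPlot_subtype_iff.mpr hr.1)
  have h2 : IsPlot fun y => κ ⟨(r y).2, (hrU y).2⟩ :=
    hκ k (fun y => ⟨(r y).2, (hrU y).2⟩) (isPlot_subtype_iff.mpr hr.2)
  -- With `p = s κ(p)` and `q = s κ(q)` over the same base point, the quotient is `g = κ(p)⁻¹ κ(q)`.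
  refine ⟨_, h1.pin_inv.pin_mul h2, ?_⟩
  filter_upwards [hre] with y hy
  have hy1 : (r y).1 = p y := congrArg Prod.fst hy
  have hy2 : (r y).2 = MulOpposite.op (g y) • (r y).1 := by
    rw [hy1, ← hg]
    exact congrArg Prod.snd hy
  have h3 := hsκ ⟨(r y).1, (hrU y).1⟩
  have h4 := hsκ ⟨(r y).2, (hrU y).2⟩
  have h5 : s ⟨π (r y).2, (hrU y).2⟩ = s ⟨π (r y).1, (hrU y).1⟩ :=
    congrArg s (Subtype.ext ((congrArg π hy2).trans (hπ.proj_smul _ _)))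
  refine (inv_mul_eq_iff_eq_mul.mpr ?_).symm
  refine hπ.smul_left_cancel (p := s ⟨π (r y).1, (hrU y).1⟩) ?_
  rw [MulOpposite.op_mul, mul_smul, ← h5, ← h4, h5, ← h3]
  exact hy2

/-- A smooth equivariant map of principal bundles over the base is a diffeomorphism. -/
theorem IsPrincipalBundle.exists_isDiffeo (hπ : IsPrincipalBundle (Pin m n) π)
    (hπ' : IsPrincipalBundle (Pin m n) π') {f : E → E'} (hf : DSmooth f)
    (hover : ∀ e, π' (f e) = π e)
    (heq : ∀ (g : Pin m n) (e : E), f (MulOpposite.op g • e) = MulOpposite.op g • f e) :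
    ∃ F : E ≃ E', IsDiffeo F ∧ ∀ e, F e = f e := by
  have hbij : Function.Bijective f := by
    constructor
    · intro e e' h
      obtain ⟨g, rfl⟩ := hπ.exists_smul_eq (show π e = π e' by rw [← hover, h, hover])
      rw [heq] at h
      rw [hπ'.eq_one_of_smul_eq h.symm, MulOpposite.op_one, one_smul]
    · intro e'
      obtain ⟨e, he⟩ := hπ.surjective (π' e')
      obtain ⟨g, rfl⟩ := hπ'.exists_smul_eq (show π' (f e) = π' e' by rw [hover, he])
      exact ⟨MulOpposite.op g • e, heq g e⟩
  refine ⟨Equiv.ofBijective f hbij, ⟨hf, dSmooth_symm_of_lift fun k p hp x => ?_⟩, fun _ => rfl⟩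
  -- The base path of `p` is lifted to `E` first. Its image under `f` is in the fibre of `p`, and
  -- the smooth quotient in `E'` corrects the lift.
  obtain ⟨q, hq, hqp⟩ := hπ.exists_lift (hπ'.smooth_proj k p hp) x
  obtain ⟨r, hr, hrU, hre⟩ := exists_isPlot_forall (r := fun a : E × E' => π a.1 = π' a.2)
    (show IsPlot fun y => (q y, p y) from ⟨hq, hp⟩) hqp
  choose g hg using fun y => hπ'.exists_smul_eq
    (show π' (f (r y).1) = π' (r y).2 by rw [hover, hrU])
  have hgp : IsPlot g := hπ'.isPlot_div (hf k _ hr.1) hr.2 hg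
  refine ⟨fun y => MulOpposite.op (g y) • (r y).1,
    hπ.smooth_action k (fun y => ((r y).1, g y)) ⟨hr.1, hgp⟩, ?_⟩
  filter_upwards [hre] with y hy
  change p y = f (MulOpposite.op (g y) • (r y).1)
  rw [heq, ← hg]
  exact (congrArg Prod.snd hy).symm

end Principal

/-! ### The sign homomorphism to the kernel of `ζ` -/

section Sign

variable {m n : ℕ}

/-- The isomorphism of `ℤ/2` with the kernel `{1, -1}` of `ζ`. -/
def pinSign (hn0 : 0 < n) (a : ZMod 2) : Pin m n :=
  if a = 0 then 1 else ⟨-1, neg_one_mem_pin hn0⟩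

theorem val_pinSign (hn0 : 0 < n) (a : ZMod 2) :
    ((pinSign hn0 a : Pin m n) : (RealClifford m n)ˣ) = if a = 0 then 1 else -1 := by
  unfold pinSign; split_ifs <;> rfl

theorem pinSign_add (hn0 : 0 < n) (a b : ZMod 2) :
    (pinSign hn0 (a + b) : Pin m n) = pinSign hn0 a * pinSign hn0 b := by
  refine Subtype.ext ?_
  rw [Subgroup.coe_mul, val_pinSign, val_pinSign, val_pinSign]
  have h : (a + b = 0) ↔ (a = 0 ↔ b = 0) := by revert a b; decide
  simp only [h]
  by_cases ha : a = 0 <;> by_cases hb : b = 0 <;> simp [ha, hb]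

theorem pinSign_comm (hn0 : 0 < n) (a : ZMod 2) (g : Pin m n) :
    pinSign hn0 a * g = g * pinSign hn0 a := by
  refine Subtype.ext ?_
  rw [Subgroup.coe_mul, Subgroup.coe_mul, val_pinSign]
  split_ifs <;> simp

theorem pinSign_injective (hn0 : 0 < n) :
    Function.Injective (pinSign hn0 : ZMod 2 → Pin m n) := by
  have hne : (1 : (RealClifford m n)ˣ) ≠ -1 := fun h => by
    have h1 : (1 : RealClifford m n) = -1 := by simpa using congrArg Units.val h
    have h2 : (1 : ℝ) = -1 := (algebraMap ℝ (RealClifford m n)).injective (by simpa using h1)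
    norm_num at h2
  intro a b h
  have h1 := congrArg Subtype.val h
  rw [val_pinSign, val_pinSign] at h1
  have h2 : (a = 0 ↔ b = 0) := by
    by_cases ha : a = 0 <;> by_cases hb : b = 0 <;> simp_all
  clear h h1
  revert a b; decide

theorem zeta_pinSign (hn0 : 0 < n) (a : ZMod 2) : zeta m n (pinSign hn0 a) = 1 := by
  unfold pinSign
  split_ifs
  exacts [map_one _, zeta_neg_one hn0]

theorem exists_pinSign_of_zeta_eq_one (hn : Even n) (hn0 : 0 < n) {g : Pin m n}
    (hg : zeta m n g = 1) : ∃ a, g = pinSign hn0 a := by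
  rcases eq_one_or_eq_neg_one_of_zeta_eq_one hn hg with h | h
  · exact ⟨0, Subtype.ext (by rw [h, val_pinSign, if_pos rfl])⟩
  · exact ⟨1, Subtype.ext (by rw [h, val_pinSign, if_neg one_ne_zero])⟩

end Sign

/-! ### Equivalence of Pin-lifts over a manifold with trivial `H¹(X; ℤ/2)` -/

section LiftEquivalence

variable {m n : ℕ} {X : Type u} [TopologicalSpace X] [ChartedSpace (EuclideanSpace ℝ (Fin n)) X]
  [IsManifold (𝓡 n) ∞ X] [dX : DiffeologicalSpace X] {L Q Q' : Type*} [DiffeologicalSpace L]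
  [DiffeologicalSpace Q] [DiffeologicalSpace Q'] [MulAction (Orth m n)ᵐᵒᵖ L]
  [MulAction (Pin m n)ᵐᵒᵖ Q] [MulAction (Pin m n)ᵐᵒᵖ Q'] {πL : L → X} {z : Q → L} {z' : Q' → L}

/-- `f` is an isomorphism of lifts over `U`. -/
structure IsLiftMapOn (m n : ℕ) {X L Q Q' : Type*} [DiffeologicalSpace Q] [DiffeologicalSpace Q']
    [MulAction (Pin m n)ᵐᵒᵖ Q] [MulAction (Pin m n)ᵐᵒᵖ Q'] (πL : L → X) (z : Q → L) (z' : Q' → L)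
    (U : Set X) (f : Q → Q') : Prop where
  lift : ∀ q, πL (z q) ∈ U → z' (f q) = z q
  equivariant : ∀ (g : Pin m n) (q : Q), πL (z q) ∈ U →
    f (MulOpposite.op g • q) = MulOpposite.op g • f q
  smooth : ∀ (k : ℕ) (p : EuclideanSpace ℝ (Fin k) → Q), IsPlot p → (∀ y, πL (z (p y)) ∈ U) →
    IsPlot fun y => f (p y)

/-- A local section of `Q`, viewed in `L` and read in a chart, lifts to `Q'` because `z'` is
submersive. Sending the section to this lift and extending equivariantly gives the isomorphism. -/
theorem exists_isLiftMapOn (hX : dX = manifoldDiffeology (𝓡 n) X) (hz : IsPinLift m n πL z)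
    (hz' : IsPinLift m n πL z') (x : X) :
    ∃ (U : Set X) (f : Q → Q'), IsOpen U ∧ x ∈ U ∧ IsLiftMapOn m n πL z z' U f := by
  classical
  subst hX
  let _ : DiffeologicalSpace X := manifoldDiffeology (𝓡 n) X
  obtain ⟨U, hU, hx, s, κ, hs, hκ, hπs, hsκ, -⟩ := hz.principal.exists_section x
  obtain ⟨e, c, V, he, heU, hV, hxV, hVU, hec, hc, hcp⟩ :=
    exists_chart_plot (n := n) ((isOpen_manifoldDiffeology_iff (n := n)).mp hU) hx
  have hp : IsPlot fun t => z (s ⟨e t, heU t⟩) :=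
    (hz.smooth.comp hs) n (fun t => ⟨e t, heU t⟩) (isPlot_subtype_iff.mpr he)
  obtain ⟨r, hr, hre⟩ := hz'.submersive n _ hp (c x)
  obtain ⟨N, hN, hNo, hxN⟩ := eventually_nhds_iff.mp hre
  let f : Q → Q' := fun q =>
    if h : πL (z q) ∈ U then MulOpposite.op (κ ⟨q, h⟩) • r (c (πL (z q))) else r (c x)
  have hfU : ∀ q (h : πL (z q) ∈ U), f q = MulOpposite.op (κ ⟨q, h⟩) • r (c (πL (z q))) :=
    fun q h => dif_pos h
  refine ⟨V ∩ c ⁻¹' N, f, hc.isOpen_inter_preimage hV hNo, ⟨hxV, hxN⟩, ?_, ?_, ?_⟩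
  · intro q hq
    rw [hfU q (hVU hq.1), hz'.equivariant, ← show z (s _) = z' (r _) from hN _ hq.2]
    have h1 : s ⟨e (c (πL (z q))), heU _⟩ = s ⟨πL (z q), hVU hq.1⟩ :=
      congrArg s (Subtype.ext (hec _ hq.1))
    rw [h1, ← hz.equivariant]
    exact congrArg z (hsκ ⟨q, hVU hq.1⟩).symm
  · intro g q hq
    have hgq : πL (z (MulOpposite.op g • q)) = πL (z q) := hz.principal.proj_smul g q
    have hgU : πL (z (MulOpposite.op g • q)) ∈ U := hgq ▸ hVU hq.1
    have h1 := hsκ ⟨q, hVU hq.1⟩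
    have h2 := hsκ ⟨MulOpposite.op g • q, hgU⟩
    have h3 : s ⟨πL (z (MulOpposite.op g • q)), hgU⟩ = s ⟨πL (z q), hVU hq.1⟩ :=
      congrArg s (Subtype.ext hgq)
    have h4 : κ ⟨MulOpposite.op g • q, hgU⟩ = κ ⟨q, hVU hq.1⟩ * g := by
      refine hz.principal.smul_left_cancel (p := s ⟨πL (z q), hVU hq.1⟩) ?_
      rw [MulOpposite.op_mul, mul_smul]
      refine Eq.trans ?_ (congrArg (MulOpposite.op g • ·) h1)
      rw [← h3]
      exact h2.symm
    rw [hfU _ hgU, hfU _ (hVU hq.1), h4, hgq, MulOpposite.op_mul, mul_smul]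
  · intro k p hp hpU
    have hκp : IsPlot fun y => κ ⟨p y, hVU (hpU y).1⟩ :=
      hκ k (fun y => ⟨p y, hVU (hpU y).1⟩) (isPlot_subtype_iff.mpr hp)
    have hrp : IsPlot fun y => r (c (πL (z (p y)))) :=
      isPlot_reparam hr (hcp k _ (hz.principal.smooth_proj k p hp) fun y => (hpU y).1)
    have h1 := hz'.principal.smooth_action k (fun y => (_, _)) ⟨hrp, hκp⟩
    have h2 : (fun y => f (p y)) =
        fun y => MulOpposite.op (κ ⟨p y, hVU (hpU y).1⟩) • r (c (πL (z (p y)))) :=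
      funext fun y => hfU _ _
    rw [h2]
    exact h1

-- Both maps lift the same point of `L`, so they differ by some `k`, and freeness of the orthogonal
-- action gives `ζ k = 1`. Since `±1` is central, the sign found at one point serves the whole
-- fibre.
omit [TopologicalSpace X] [ChartedSpace (EuclideanSpace ℝ (Fin n)) X] [IsManifold (𝓡 n) ∞ X] in
theorem exists_pinSign_of_isLiftMapOn (hn : Even n) (hn0 : 0 < n)
    (hfree : ∀ (A : Orth m n) (l : L), MulOpposite.op A • l = l → A = 1)
    (hz : IsPinLift m n πL z) (hz' : IsPinLift m n πL z') {U V : Set X} {f g : Q → Q'}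
    (hf : IsLiftMapOn m n πL z z' U f) (hg : IsLiftMapOn m n πL z z' V g) {x : X}
    (hx : x ∈ U ∩ V) :
    ∃ a : ZMod 2, ∀ q, πL (z q) = x → g q = MulOpposite.op (pinSign hn0 a : Pin m n) • f q := by
  obtain ⟨q, rfl⟩ := hz.principal.surjective x
  have hzz : z' (f q) = z' (g q) := by rw [hf.lift q hx.1, hg.lift q hx.2]
  obtain ⟨k, hk⟩ := hz'.principal.exists_smul_eq (congrArg πL hzz)
  have hk1 : zeta m n k = 1 := by
    refine hfree _ (z' (f q)) ?_
    rw [← hz'.equivariant, ← hk, hzz]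
  obtain ⟨a, rfl⟩ := exists_pinSign_of_zeta_eq_one hn hn0 hk1
  refine ⟨a, fun q' hq' => ?_⟩
  obtain ⟨j, rfl⟩ := hz.principal.exists_smul_eq (p := q) (p' := q') hq'.symm
  rw [hg.equivariant j q hx.2, hf.equivariant j q hx.1, hk, smul_smul, smul_smul,
    ← MulOpposite.op_mul, ← MulOpposite.op_mul, pinSign_comm]

/-- Along a local section in a chart, the sign is the quotient of two plots of `Q'`. It is therefore
a plot of Pin with values `±1`, hence locally constant, and the chart carries this back to `X`. -/
theorem eventually_eq_of_pinSign (hn0 : 0 < n) (hX : dX = manifoldDiffeology (𝓡 n) X)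
    (hz : IsPinLift m n πL z) (hz' : IsPinLift m n πL z') {U V : Set X} (hU : IsOpen U)
    (hV : IsOpen V) {f g : Q → Q'} (hf : IsLiftMapOn m n πL z z' U f)
    (hg : IsLiftMapOn m n πL z z' V g) {a : X → ZMod 2}
    (ha : ∀ q, πL (z q) ∈ U ∩ V →
      g q = MulOpposite.op (pinSign hn0 (a (πL (z q))) : Pin m n) • f q)
    {x : X} (hx : x ∈ U ∩ V) : ∀ᶠ y in 𝓝 x, a y = a x := by
  subst hX
  let _ : DiffeologicalSpace X := manifoldDiffeology (𝓡 n) X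
  obtain ⟨U', hU', hx', s, -, hs, -, hπs, -⟩ := hz.principal.exists_section x
  obtain ⟨e, c, W, he, heU, hW, hxW, -, hec, hc, -⟩ :=
    exists_chart_plot (n := n) ((hU.inter hV).inter ((isOpen_manifoldDiffeology_iff (n := n)).mp hU')) ⟨hx, hx'⟩
  have hsp : IsPlot fun t => s ⟨e t, (heU t).2⟩ :=
    hs n (fun t => ⟨e t, (heU t).2⟩) (isPlot_subtype_iff.mpr he)
  have hπe : ∀ t, πL (z (s ⟨e t, (heU t).2⟩)) = e t := fun t => hπs _
  have h1 : IsPlot fun t => (pinSign hn0 (a (e t)) : Pin m n) := by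
    refine hz'.principal.isPlot_div (hf.smooth n _ hsp fun t => ?_) (hg.smooth n _ hsp fun t => ?_)
      fun t => ?_
    · rw [hπe]; exact (heU t).1.1
    · rw [hπe]; exact (heU t).1.2
    · have h2 := ha (s ⟨e t, (heU t).2⟩) (by rw [hπe]; exact (heU t).1)
      rwa [hπe] at h2
  have h2 := eventually_eq_of_isPlot_pin h1 (fun t => by
    rw [val_pinSign]; split_ifs <;> simp) (c x)
  have h3 : Filter.Tendsto c (𝓝 x) (𝓝 (c x)) := (hc.continuousAt (hW.mem_nhds hxW))
  filter_upwards [h3.eventually h2, hW.mem_nhds hxW] with y hy hyW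
  rw [hec y hyW, hec x hxW] at hy
  exact pinSign_injective hn0 hy

/-- If `H¹(X; ℤ/2)` is trivial, any two Pin-lifts of a bundle over `X` are equivalent. -/
theorem exists_equiv_of_cechH1Trivial (hn : Even n) (hn0 : 0 < n)
    (hX : dX = manifoldDiffeology (𝓡 n) X)
    (hfree : ∀ (A : Orth m n) (l : L), MulOpposite.op A • l = l → A = 1)
    (hz : IsPinLift m n πL z) (hz' : IsPinLift m n πL z') (hH : CechH1Trivial X) :
    ∃ F : Q ≃ Q', IsDiffeo F ∧ (∀ q, z' (F q) = z q) ∧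
      ∀ (g : Pin m n) (q : Q), F (MulOpposite.op g • q) = MulOpposite.op g • F q := by
  -- The cover is indexed by the points of `X`, which places its index type in the universe required
  -- by `CechH1Trivial`.
  choose U f hU hxU hf using exists_isLiftMapOn (m := m) hX hz hz'
  have hex : ∀ i j x, ∃ a : ZMod 2, x ∈ U i ∩ U j →
      ∀ q, πL (z q) = x → f j q = MulOpposite.op (pinSign hn0 a : Pin m n) • f i q := fun i j x => by
    by_cases hx : x ∈ U i ∩ U j
    · obtain ⟨a, ha⟩ := exists_pinSign_of_isLiftMapOn hn hn0 hfree hz hz' (hf i) (hf j) hx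
      exact ⟨a, fun _ => ha⟩
    · exact ⟨0, fun h => absurd h hx⟩
  choose a ha using hex
  have hloc : ∀ i j, ∀ x ∈ U i ∩ U j, ∀ᶠ y in 𝓝 x, a i j y = a i j x := fun i j x hx =>
    eventually_eq_of_pinSign hn0 hX hz hz' (hU i) (hU j) (hf i) (hf j)
      (fun q hq => ha i j _ hq q rfl) hx
  have hcoc : ∀ i j k, ∀ x ∈ U i ∩ U j ∩ U k, a i j x + a j k x = a i k x := by
    rintro i j k x ⟨⟨hi, hj⟩, hk⟩
    obtain ⟨q, hq⟩ := hz.principal.surjective x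
    refine pinSign_injective (m := m) hn0 (hz'.principal.smul_left_cancel (p := f i q) ?_)
    rw [← ha i k x ⟨hi, hk⟩ q hq, ha j k x ⟨hj, hk⟩ q hq, ha i j x ⟨hi, hj⟩ q hq, pinSign_add,
      MulOpposite.op_mul, mul_smul]
  obtain ⟨K, V, r, c, hV, hcov, hVU, hcl, hc⟩ :=
    hH X U a hU (fun x => ⟨x, hxU x⟩) hloc hcoc
  choose α hα using hcov
  -- The index `α x` is chosen without any continuity; `hF` shows that the corrected value does not
  -- depend on it.
  let F : Q → Q' := fun q =>
    MulOpposite.op (pinSign hn0 (c (α (πL (z q))) (πL (z q))) : Pin m n) • f (r (α (πL (z q)))) q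
  have hF : ∀ b q, πL (z q) ∈ V b →
      F q = MulOpposite.op (pinSign hn0 (c b (πL (z q))) : Pin m n) • f (r b) q := fun b q hq => by
    have hx := hα (πL (z q))
    -- The transition sign is `t - s` and the correction on the other set is `t`; modulo 2 they
    -- combine to `s`.
    have h2 : ∀ s t : ZMod 2, (t - s) + t = s := by decide
    rw [ha (r (α (πL (z q)))) (r b) _ ⟨hVU _ hx, hVU b hq⟩ q rfl, hc _ _ _ ⟨hx, hq⟩, smul_smul,
      ← MulOpposite.op_mul, ← pinSign_add, h2]
  have hFz : ∀ q, z' (F q) = z q := fun q => by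
    change z' (MulOpposite.op _ • _) = _
    rw [hz'.equivariant, zeta_pinSign, MulOpposite.op_one, one_smul]
    exact (hf _).lift q (hVU _ (hα _))
  have hFe : ∀ (g : Pin m n) (q : Q), F (MulOpposite.op g • q) = MulOpposite.op g • F q := by
    intro g q
    have hgq : πL (z (MulOpposite.op g • q)) = πL (z q) := hz.principal.proj_smul g q
    rw [hF (α (πL (z q))) q (hα _), hF (α (πL (z q))) _ (by rw [hgq]; exact hα _),
      (hf _).equivariant g q (hVU _ (hα _)), hgq, smul_smul, smul_smul, ← MulOpposite.op_mul,
      ← MulOpposite.op_mul, pinSign_comm]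
  have hFs : DSmooth F := by
    -- Near `q₀` the index is frozen at `α x₀` and the cochain is constant, so `F` is a smooth local
    -- isomorphism followed by one fixed group element.
    refine dSmooth_of_locally fun q₀ => ?_
    set x₀ := πL (z q₀) with hx₀
    obtain ⟨N, hN, hNo, hxN⟩ := eventually_nhds_iff.mp (hcl (α x₀) x₀ (hα x₀))
    have hW : IsOpen[dTopology] (V (α x₀) ∩ N) := by
      subst hX
      exact isOpen_manifoldDiffeology_iff.mpr ((hV _).inter hNo)
    refine ⟨(πL ∘ z) ⁻¹' (V (α x₀) ∩ N), hz.principal.smooth_proj.isOpen_preimage hW,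
      ⟨hα x₀, hxN⟩, fun k p hp => ?_⟩
    have h1 := (hf (r (α x₀))).smooth k _ (isPlot_subtype_iff.mp hp) fun y => hVU _ (p y).2.1
    have h2 := hz'.principal.smooth_action k
      (fun y => (f (r (α x₀)) (p y), (pinSign hn0 (c (α x₀) x₀) : Pin m n))) ⟨h1, isPlot_const⟩
    have h3 : ((fun u : (πL ∘ z) ⁻¹' (V (α x₀) ∩ N) => F u) ∘ p) = fun y =>
        MulOpposite.op (pinSign hn0 (c (α x₀) x₀) : Pin m n) • f (r (α x₀)) (p y) :=
      funext fun y => by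
        have h4 : c (α x₀) (πL (z (p y))) = c (α x₀) x₀ := hN _ (p y).2.2
        rw [← h4]
        exact hF _ _ (p y).2.1
    rw [h3]
    exact h2
  obtain ⟨G, hG, hGF⟩ := hz.principal.exists_isDiffeo hz'.principal hFs
    (fun q => congrArg πL (hFz q)) hFe
  exact ⟨G, hG, fun q => by rw [hGF, hFz], fun g q => by rw [hGF, hGF, hFe]⟩

end LiftEquivalence

/-! ### Freeness of the orthogonal action on frames -/

section FrameBundle

variable {m n : ℕ} {X : Type*} [TopologicalSpace X] [ChartedSpace (EuclideanSpace ℝ (Fin n)) X]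
  [IsManifold (𝓡 n) ∞ X] {h : X → MetricBundle m n X}

omit [IsManifold (𝓡 n) ∞ X] in
theorem eq_one_of_smul_reducedFrames (A : Orth m n) (l : ReducedFrames h)
    (hA : MulOpposite.op A • l = l) : A = 1 := by
  obtain ⟨⟨x, φ⟩, hl⟩ := l
  have h1 : (⟨x, A.1 ≪≫ₗ φ⟩ : FrameBundle n X) = ⟨x, φ⟩ := congrArg Subtype.val hA
  have h2 : A.1 ≪≫ₗ φ = φ := eq_of_heq (Sigma.mk.inj h1).2
  refine Subtype.ext (LinearEquiv.ext fun v => φ.injective ?_)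
  exact LinearEquiv.congr_fun h2 v

end FrameBundle

end CompositeClifford

/-! ### The pulled-back bundles and their comparison -/

theorem mainTheorem11 {m n : ℕ} (hn : Even n) (hn0 : 0 < n) (hm : m ≤ n)
    {X : Type u} [TopologicalSpace X] [ChartedSpace (EuclideanSpace ℝ (Fin n)) X]
    [IsManifold (𝓡 n) ∞ X]
    {P : Type v} [DiffeologicalSpace P] [MulAction (Pin m n)ᵐᵒᵖ P]
    (z : P → FrameBundle n X) (hz : IsPinLift m n (toMetric m) z)
    (Ψ : Ideal (ComplexClifford n)) (hΨ : IsAtom Ψ)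
    (h : X → MetricBundle m n X) (hh : IsGlobalSection h) :
    letI : DiffeologicalSpace X := manifoldDiffeology (𝓡 n) X
    letI : MulAction (Pin m n)ᵐᵒᵖ (PullbackPin h z) :=
      pullbackPinAction h z hz.principal.proj_smul
    -- the bundles over `Σ(m, n - m)`
    let πC : CliffordBundle m n P → MetricBundle m n X :=
      cproj m n (toMetric m ∘ z) hz.principal.proj_smul
    let πR : RealCliffordBundle m n P → MetricBundle m n X := fun c => πC c
    let πS : SpinorBundle m n P Ψ → MetricBundle m n X :=
      cproj m n (toMetric m ∘ z) hz.principal.proj_smul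
    -- `h^*P` is a Pin-lift of the reduced subbundle `L^hX`
    IsPinLift m n ReducedFrames.proj (pullbackLift h z) ∧
    -- the pull-backs are subbundles of the composite bundles over `X`
    IsSubbundle (ComplexClifford n) (Pullback.base : Pullback h πC → X)
      (MetricBundle.proj ∘ πC) Pullback.total ∧
    IsSubbundle (RealClifford m n) (Pullback.base : Pullback h πR → X)
      (MetricBundle.proj ∘ πR) Pullback.total ∧
    IsSubbundle Ψ (Pullback.base : Pullback h πS → X)
      (MetricBundle.proj ∘ πS) Pullback.total ∧
    -- for a Pin-lift `Q` of `L^hX` equivalent to `h^*P` they are the bundles built from `Q`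
    (∀ (Q : Type w) [DiffeologicalSpace Q] [MulAction (Pin m n)ᵐᵒᵖ Q]
      (zQ : Q → ReducedFrames h) (hQ : IsPinLift m n ReducedFrames.proj zQ)
      (F : Q ≃ PullbackPin h z), IsLiftEquiv zQ F →
      ∃ (ΦC : CliffordBundle m n Q ≃ Pullback h πC)
        (ΦR : RealCliffordBundle m n Q ≃ Pullback h πR)
        (ΦS : SpinorBundle m n Q Ψ ≃ Pullback h πS),
        IsDiffeo ΦC ∧ IsDiffeo ΦR ∧ IsDiffeo ΦS ∧
        -- the maps are over `X`
        (∀ c, (ΦC c).base = cproj m n (ReducedFrames.proj ∘ zQ) hQ.principal.proj_smul c) ∧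
        (∀ c, (ΦR c).base = cproj m n (ReducedFrames.proj ∘ zQ) hQ.principal.proj_smul c.1) ∧
        (∀ s, (ΦS s).base = cproj m n (ReducedFrames.proj ∘ zQ) hQ.principal.proj_smul s) ∧
        -- they are induced by the isomorphism `F` of principal bundles
        (∀ q g a, (ΦC (cmk m n q g a)).total = cmk m n (F q).total g a) ∧
        (∀ q g a, (ΦS (cmk m n q g a)).total = cmk m n (F q).total g a) ∧
        -- they agree on the real Clifford subbundle and on the spinor subbundle
        (∀ c, ((ΦR c).total : CliffordBundle m n P) = (ΦC c).total) ∧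
        (∀ s, spinorIncl m n Ψ (ΦS s).total = (ΦC (spinorIncl m n Ψ s)).total)) ∧
    -- if `H¹(X; ℤ/2) = 0`, every Pin-lift of `L^hX` is equivalent to `h^*P`
    (CechH1Trivial X →
      ∀ (Q : Type w) [DiffeologicalSpace Q] [MulAction (Pin m n)ᵐᵒᵖ Q]
        (zQ : Q → ReducedFrames h), IsPinLift m n ReducedFrames.proj zQ →
        ∃ F : Q ≃ PullbackPin h z, IsLiftEquiv zQ F) := by
  let _ : DiffeologicalSpace X := manifoldDiffeology (𝓡 n) X
  let _ : MulAction (Pin m n)ᵐᵒᵖ (PullbackPin h z) :=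
    pullbackPinAction h z hz.principal.proj_smul
  intro πC πR πS
  have hhs : DSmooth h := hh.1
  have hinj : Function.Injective h := fun x y hxy => by rw [← hh.2 x, hxy, hh.2]
  have hpr : DSmooth (MetricBundle.proj : MetricBundle m n X → X) := dSmooth_metricBundle_proj
  have hlift : IsPinLift m n ReducedFrames.proj (pullbackLift h z) := isPinLift_pullbackLift hz hh
  refine ⟨hlift, ?_, ?_, ?_, ?_, ?_⟩
  · exact (isFibreBundle_cproj dSmooth_smul_complexClifford hz.principal).isSubbundle_pullback hhs
      hpr hh.2
  · exact (isFibreBundle_realCliffordBundle hz.principal).isSubbundle_pullback hhs hpr hh.2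
  · exact (isFibreBundle_cproj (dSmooth_smul_ideal Ψ) hz.principal).isSubbundle_pullback hhs
      hpr hh.2
  · intro Q _ _ zQ hQ F hF
    have hFbase : ∀ q, (F q).base = ReducedFrames.proj (zQ q) := fun q => by
      rw [← hF.lift, pullbackLift_proj hh]
    obtain ⟨ΦC, hC, hCb, hCt⟩ := exists_equiv_pullback (V := ComplexClifford n)
      dSmooth_smul_complexClifford hinj hz.principal.proj_smul hz.principal.smooth_proj hpr hh.2 F
      hF.isDiffeo hF.equivariant
    obtain ⟨ΦS, hS, hSb, hSt⟩ := exists_equiv_pullback (V := Ψ)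
      (dSmooth_smul_ideal Ψ) hinj hz.principal.proj_smul hz.principal.smooth_proj hpr hh.2 F
      hF.isDiffeo hF.equivariant
    obtain ⟨ΦR, hR, hRb, hRt⟩ := exists_equiv_realCliffordBundle hz.principal.proj_smul F ΦC hC
      hCt hinj
    have hCp : ∀ c, (ΦC c).base =
        cproj m n (ReducedFrames.proj ∘ zQ) hQ.principal.proj_smul c := fun c => by
      obtain ⟨q, a, rfl⟩ := cmk_surjective c
      exact (hCb q 1 a).trans (hFbase q)
    refine ⟨ΦC, ΦR, ΦS, hC, hR, hS, hCp, fun c => (hRb c).trans (hCp c.1), fun s => ?_, hCt, hSt,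
      hRt, fun s => ?_⟩
    · obtain ⟨q, a, rfl⟩ := cmk_surjective s
      exact (hSb q 1 a).trans (hFbase q)
    · obtain ⟨q, a, rfl⟩ := cmk_surjective s
      have h1 : spinorIncl m n Ψ (cmk m n q 1 a) = cmk m n q 1 (a : ComplexClifford n) := rfl
      rw [hSt, h1, hCt]
      rfl
  · intro hH Q _ _ zQ hQ
    obtain ⟨F, hF, hFz, hFe⟩ := exists_equiv_of_cechH1Trivial hn hn0 rfl
      eq_one_of_smul_reducedFrames hQ hlift hH
    exact ⟨F, hF, hFz, fun g q => congrArg Pullback.total (hFe g q)⟩
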